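/- **Setting.** Let $\mathbb{T}^+$ be $\mathbb{N}\cup\{0\}$ or $[0,\infty)$, and let $\lambda$ be the counting measure on $\mathbb{T}^+$ in the first case and the Lebesgue measure in the second. Let $(\Omega,\mathcal{F},(\mathcal{F}_t)_{t\in\mathbb{T}^+},\mathbb{P})$ be a filtered probability space, $\mathcal{F}_+:=\sigma(\mathcal{F}_t : t\in\mathbb{T}^+)$, and let $(\theta^t)_{t\in\mathbb{T}^+}$ be $\mathbb{P}$-preserving measurable maps $\Omega\to\Omega$ with $\theta^0=\mathrm{id}$ and $\theta^{s+t}=\theta^t\circ\theta^s$, such that $\theta^t$ is $(\mathcal{F}_{s+t},\mathcal{F}_s)$-measurable for all $s,t$, and $\mathcal{F}_t$ and $(\theta^{t})^{-1}\mathcal{F}_+$ are $\mathbb{P}$-independent for all $t$. Let $\mathbb{S}^1=\mathbb{R}/\mathbb{Z}$ with its quotient metric $d$ and Lebesgue measure $l$ ($l(\mathbb{S}^1)=1$). Let $\varphi=(\varphi(t,\omega))_{t\in\mathbb{T}^+,\,\omega\in\Omega}$ be a family of orientation-preserving homeomorphisms of $\mathbb{S}^1$ such that: $(\omega,x)\mapsto\varphi(t,\omega)x$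 is $\mathcal{F}_t\otimes\mathcal{B}(\mathbb{S}^1)$-measurable for each $t$; $\varphi(0,\omega)=\mathrm{id}$; $\varphi(s+t,\omega)=\varphi(t,\theta^s\omega)\circ\varphi(s,\omega)$; $\varphi(t_n,\omega)x_n\to\varphi(t,\omega)x$ whenever $(t_n)$ is decreasing with $t_n\to t$ and $x_n\to x$; and there is $\varphi_-:\mathbb{T}^+\times\Omega\times\mathbb{S}^1\to\mathbb{S}^1$ such that $\varphi(t_n,\omega)x_n\to\varphi_-(t,\omega,x)$ whenever $(t_n)$ is strictly increasing with $t_n\to t$ and $x_n\to x$. **Definitions.** A point $p$ is a *deterministic fixed point* if for $\mathbb{P}$-almost every $\omega$, $\varphi(t,\omega)p=p$ for all $t$. Write $x\sim_\omega y$ if $d(\varphi(t,\omega)x,\varphi(t,\omega)y)\to0$ as $t\to\infty$. The system $\varphi$ is *stably synchronising* if for all $x,y$, $x\sim_\omega y$ for $\mathbb{P}$-almost every $\omega$, and for all $x$, for $\mathbb{P}$-almost every $\omega$ there is an open $U\ni x$ with $l(\varphi(t,\omega)U)\to0$ as $t\to\infty$. A point $r$ is a *crack point* of $\omega$ if $l(\varphi(t,\omega)G)\to0$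 as $t\to\infty$ for every closed $G\subset\mathbb{S}^1$ with $r\notin G$ (such an $r$ is unique if it exists); it is *repulsive* if moreover the equivalence classes of $\sim_\omega$ are exactly $\{r\}$ and $\mathbb{S}^1\setminus\{r\}$. Let $\Omega_c$ be the set of $\omega$ that admit a crack point, and $\tilde r(\omega)$ the crack point of $\omega\in\Omega_c$. A probability measure $\rho$ on $\mathbb{S}^1$ is *stationary* if $\rho(A)=\int_{\mathbb{S}^1}\mathbb{P}(\omega:\varphi(t,\omega)x\in A)\,\rho(dx)$ for all $t\in\mathbb{T}^+$ and all Borel $A$. **Theorem 4.5.** The set $\Omega_c$ is $\mathcal{F}_+$-measurable and $\mathbb{P}(\Omega_c)\in\{0,1\}$. If $\mathbb{P}(\Omega_c)=1$, then either (a) $\mathbb{P}(\omega\in\Omega_c:\tilde r(\omega)=x)=0$ for every $x\in\mathbb{S}^1$; or (b) there is a deterministic fixed point $p\in\mathbb{S}^1$ with $\mathbb{P}(\omega\in\Omega_c:\tilde r(\omega)=p)=1$. The system $\varphi$ is stably synchronising if and only if $\mathbb{P}(\Omega_c)=1$ and (a) holds. In this case: (I) for $\mathbb{P}$-almost every $\omega\in\Omega_c$,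 $\tilde r(\omega)$ is a repulsive crack point of $\omega$; (II) there is exactly one stationary probability measure $\rho_{\mathrm{stat}}$, and for every connected $J\subset\mathbb{S}^1$ whose boundary $\partial J$ contains no deterministic fixed point, $\mathbb{P}$-almost every $\omega\in\Omega_c$ has the property that for all $x\in\mathbb{S}^1\setminus\{\tilde r(\omega)\}$, $$\frac1T\int_{\mathbb{T}^+\cap[0,T)}\mathbf{1}_J(\varphi(t,\omega)x)\,\lambda(dt)\;\to\;\rho_{\mathrm{stat}}(J)\qquad\text{as } T\to\infty .$$ -/

import Mathlib

open MeasureTheory Filter Topology ProbabilityTheory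
open scoped NNReal ENNReal

/-- The circle `ℝ / ℤ`, with its quotient metric and its Lebesgue measure `volume` of mass one. -/
abbrev Circ : Type := UnitAddCircle

/-- The two possible kinds of time. -/
inductive TimeDomain : Type
  | discrete
  | continuous

/-- The set of times, `{0, 1, 2, …}` or `[0, ∞)`, as an additive submonoid of `[0, ∞)`. -/
def TimeDomain.carrier : TimeDomain → AddSubmonoid ℝ≥0
  | .discrete => AddMonoidHom.mrange (Nat.castAddMonoidHom ℝ≥0)
  | .continuous => ⊤

/-- The type of times. -/
abbrev TimeDomain.Time (k : TimeDomain) : Type := k.carrier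

/-- Counting measure in discrete time, Lebesgue measure in continuous time. -/
noncomputable def TimeDomain.timeMeasure : (k : TimeDomain) → Measure k.Time
  | .discrete => Measure.count
  | .continuous => Measure.comap (fun t => ((t : ℝ≥0) : ℝ)) volume

section Noise

variable {k : TimeDomain} {Ω : Type*} [mΩ : MeasurableSpace Ω]

/-- The σ-algebra generated by all the `ℱ t`. -/
abbrev futureSigma (ℱ : Filtration k.Time mΩ) : MeasurableSpace Ω := ⨆ t, ℱ t

/-- `θ` is a semigroup of measure-preserving time shifts on the filtered probability space
`(Ω, ℱ, P)`, and the noise is memoryless. -/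
structure IsNoise (P : Measure Ω) (ℱ : Filtration k.Time mΩ) (θ : k.Time → Ω → Ω) : Prop where
  measurePreserving : ∀ t, MeasurePreserving (θ t) P P
  zero : θ 0 = id
  add : ∀ s t, θ (s + t) = θ t ∘ θ s
  adapted : ∀ s t, Measurable[ℱ (s + t), ℱ s] (θ t)
  indep : ∀ t, Indep (ℱ t) ((futureSigma ℱ).comap (θ t)) P

/-- A homeomorphism of the circle preserves the orientation if it has a continuous nondecreasing
lift `F : ℝ → ℝ` with `F (x + 1) = F x + 1`. -/
def OrientationPreserving (f : Circ ≃ₜ Circ) : Prop :=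
  ∃ F : CircleDeg1Lift, Continuous F ∧ ∀ x : ℝ, ((F x : ℝ) : Circ) = f (x : Circ)

/-- `φ` is an invertible (orientation-preserving, càdlàg) random dynamical system on the circle
over the noise `(ℱ, θ)`. -/
structure IsRDS (ℱ : Filtration k.Time mΩ) (θ : k.Time → Ω → Ω)
    (φ : k.Time → Ω → (Circ ≃ₜ Circ)) : Prop where
  orientationPreserving : ∀ t ω, OrientationPreserving (φ t ω)
  measurable : ∀ t,
    Measurable[(ℱ t).prod (inferInstance : MeasurableSpace Circ)]
      (fun p : Ω × Circ => φ t p.1 p.2)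
  zero : ∀ ω x, φ 0 ω x = x
  cocycle : ∀ s t ω x, φ (s + t) ω x = φ t (θ s ω) (φ s ω x)
  right_continuous : ∀ (u : ℕ → k.Time) (t : k.Time) (x : ℕ → Circ) (y : Circ),
    Antitone u → Tendsto u atTop (𝓝 t) → Tendsto x atTop (𝓝 y) →
      ∀ ω, Tendsto (fun n => φ (u n) ω (x n)) atTop (𝓝 (φ t ω y))
  left_limits : ∃ φm : k.Time → Ω → Circ → Circ,
    ∀ (u : ℕ → k.Time) (t : k.Time) (x : ℕ → Circ) (y : Circ),
      StrictMono u → Tendsto u atTop (𝓝 t) → Tendsto x atTop (𝓝 y) →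
        ∀ ω, Tendsto (fun n => φ (u n) ω (x n)) atTop (𝓝 (φm t ω y))

/-- `p` is a deterministic fixed point of `φ`. -/
def IsDetFixedPoint (P : Measure Ω) (φ : k.Time → Ω → (Circ ≃ₜ Circ)) (p : Circ) : Prop :=
  ∀ᵐ ω ∂P, ∀ t, φ t ω p = p

/-- The trajectories of `x` and `y` synchronise under the noise realisation `ω`. -/
def Synced (φ : k.Time → Ω → (Circ ≃ₜ Circ)) (ω : Ω) (x y : Circ) : Prop :=
  Tendsto (fun t => dist (φ t ω x) (φ t ω y)) atTop (𝓝 0)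

def Synchronising (P : Measure Ω) (φ : k.Time → Ω → (Circ ≃ₜ Circ)) : Prop :=
  ∀ x y, ∀ᵐ ω ∂P, Synced φ ω x y

def EverywhereLocallyStable (P : Measure Ω) (φ : k.Time → Ω → (Circ ≃ₜ Circ)) : Prop :=
  ∀ x, ∀ᵐ ω ∂P, ∃ U : Set Circ, IsOpen U ∧ x ∈ U ∧
    Tendsto (fun t => volume (φ t ω '' U)) atTop (𝓝 0)

def StablySynchronising (P : Measure Ω) (φ : k.Time → Ω → (Circ ≃ₜ Circ)) : Prop :=
  Synchronising P φ ∧ EverywhereLocallyStable P φ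

/-- `r` is a crack point of `ω`: every closed set that avoids `r` is contracted to length zero. -/
def IsCrackPoint (φ : k.Time → Ω → (Circ ≃ₜ Circ)) (ω : Ω) (r : Circ) : Prop :=
  ∀ G : Set Circ, IsClosed G → r ∉ G → Tendsto (fun t => volume (φ t ω '' G)) atTop (𝓝 0)

/-- `r` is a crack point of `ω` and the classes of the relation `Synced φ ω` are `{r}` and its
complement. -/
def IsRepulsiveCrackPoint (φ : k.Time → Ω → (Circ ≃ₜ Circ)) (ω : Ω) (r : Circ) : Prop :=
  IsCrackPoint φ ω r ∧ ∀ x y, Synced φ ω x y ↔ (x = r ↔ y = r)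

/-- The set of contractive sample points, i.e. those that admit a crack point. -/
def contractiveSet (φ : k.Time → Ω → (Circ ≃ₜ Circ)) : Set Ω := {ω | ∃ r, IsCrackPoint φ ω r}

/-- The crack point of a contractive sample point (it is unique: `IsCrackPoint.unique`). -/
noncomputable def crackPoint (φ : k.Time → Ω → (Circ ≃ₜ Circ)) (ω : contractiveSet φ) : Circ :=
  ω.2.choose

/-- The event that the sample point is contractive with crack point `x`. -/
def crackEvent (φ : k.Time → Ω → (Circ ≃ₜ Circ)) (x : Circ) : Set Ω :=
  {ω | ∃ h : ω ∈ contractiveSet φ, crackPoint φ ⟨ω, h⟩ = x}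

/-- The probability measure `ρ` is stationary for the transition probabilities
`(x, t) ↦ P (φ t · x ∈ A)`. -/
def IsStationaryMeasure (P : Measure Ω) (φ : k.Time → Ω → (Circ ≃ₜ Circ))
    (ρ : Measure Circ) : Prop :=
  IsProbabilityMeasure ρ ∧
    ∀ t, ∀ A : Set Circ, MeasurableSet A → ρ A = ∫⁻ x, P {ω | φ t ω x ∈ A} ∂ρ

/-- The proportion of time before `T` that the trajectory of `x` spends in `J`. -/
noncomputable def timeAverage (φ : k.Time → Ω → (Circ ≃ₜ Circ)) (ω : Ω) (x : Circ)
    (J : Set Circ) (T : ℝ) : ℝ :=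
  1 / T * ∫ t in {t : k.Time | ((t : ℝ≥0) : ℝ) < T},
    J.indicator (fun _ => (1 : ℝ)) (φ t ω x) ∂k.timeMeasure

end Noise

theorem IsCrackPoint.unique {k : TimeDomain} {Ω : Type*} {φ : k.Time → Ω → (Circ ≃ₜ Circ)}
    {ω : Ω} {r q : Circ}
    (hr : IsCrackPoint φ ω r) (hq : IsCrackPoint φ ω q) : r = q := by
  by_contra hne
  obtain ⟨U, V, hU, hV, hrU, hqV, hd⟩ := t2_separation hne
  have h1 := hr Uᶜ hU.isClosed_compl (by simpa using hrU)
  have h2 := hq Vᶜ hV.isClosed_compl (by simpa using hqV)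
  have h := h1.add h2
  have key : ∀ t, (1 : ℝ≥0∞) ≤ volume (φ t ω '' Uᶜ) + volume (φ t ω '' Vᶜ) := by
    intro t
    refine le_trans ?_ (measure_union_le _ _)
    rw [← Set.image_union, ← Set.compl_inter, hd.inter_eq, Set.compl_empty, Set.image_univ,
      (φ t ω).surjective.range_eq, UnitAddCircle.measure_univ]
  have := ge_of_tendsto' h key
  simp at this

/-!
Contractivity and the position of the crack point depend only on the future, and the crack point
`r̃` is equivariant: `r̃ (θ t ω) = φ t ω (r̃ ω)`. As the future after `t` is independent of the past
up to `t`, contractivity obeys a zero-one law, and given the past `r̃ = x` has probability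
`μ {φ t ω x}`, where `μ` is the law of `r̃`. So if `p` is an atom of maximal mass, then its images
have the same mass, and `r̃ = p` is independent of every past; it therefore has probability one, and
`p` is fixed.

Under stable synchronisation the end points of an arc eventually have close images, so the arc or
its complement is mapped into a ball so small that it is contracted with high probability. Thus
every arc of a countable family is contracted or has a contracted complement, which locates a crack
point.

The time averages of a continuous `f` converge to `ρ_stat f` because `P_m f` is uniformly close to
`ρ_stat f` for large `m`, while the differences `f (φ (t + m) x) - (P_m f) (φ t x)` are bounded and
are uncorrelated for times at least `m` apart, so that they average out along the squares, and then
along all times. Away from deterministic fixed points `ρ_stat` has no atoms, so that the convergence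
passes from continuous functions to arcs.
-/

/-! ### Geometry of the circle -/

theorem nonempty_inter_frontier_of_isPreconnected {X : Type*} [TopologicalSpace X] {S C : Set X}
    (hS : IsPreconnected S) (hC : (S ∩ C).Nonempty) (hC' : (S ∩ Cᶜ).Nonempty) :
    (S ∩ frontier C).Nonempty := by
  by_contra hcon
  have hcov : S ⊆ interior C ∪ interior Cᶜ := fun w hw => by
    by_contra h
    rw [Set.mem_union, not_or, interior_compl, Set.notMem_compl_iff] at h
    exact hcon ⟨w, hw, h.2, h.1⟩
  obtain ⟨y, hyS, hyC⟩ := hC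
  obtain ⟨z, hzS, hzC⟩ := hC'
  obtain ⟨w, -, hw, hw'⟩ := hS _ _ isOpen_interior isOpen_interior hcov
    ⟨y, hyS, (hcov hyS).resolve_right fun h => interior_subset h hyC⟩
    ⟨z, hzS, (hcov hzS).resolve_left fun h => hzC (interior_subset h)⟩
  exact interior_subset hw' (interior_subset hw)

namespace Circ

theorem isQuotientMap_coe : IsQuotientMap ((↑) : ℝ → Circ) :=
  QuotientAddGroup.isQuotientMap_mk _

theorem norm_coe_eq_min_of_mem_Ico {s : ℝ} (hs : s ∈ Set.Ico (0 : ℝ) 1) :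
    ‖(s : Circ)‖ = min s (1 - s) := by
  rw [UnitAddCircle.norm_eq, abs_sub_round_eq_min, Int.fract_eq_self.2 hs]

theorem exists_mem_Ico_eq_add (x z : Circ) : ∃ s ∈ Set.Ico (0 : ℝ) 1, z = x + (s : Circ) := by
  obtain ⟨s, hs, hz⟩ : z - x ∈ ((↑) : ℝ → Circ) '' Set.Ico 0 (0 + 1) := by
    rw [AddCircle.coe_image_Ico_eq]; trivial
  exact ⟨s, by rwa [zero_add] at hs, by rw [hz, add_sub_cancel]⟩

instance : LocallyConnectedSpace Circ := isQuotientMap_coe.isCoinducing.locallyConnectedSpace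

theorem isPreconnected_compl_ball (x : Circ) (r : ℝ) : IsPreconnected (Metric.ball x r)ᶜ := by
  have key : (Metric.ball x r)ᶜ =
      (fun s : ℝ => x + (s : Circ)) '' (Set.Ico 0 1 ∩ Set.Icc r (1 - r)) := by
    ext z
    obtain ⟨s, hs, rfl⟩ := exists_mem_Ico_eq_add x z
    simp only [Set.mem_compl_iff, mem_ball_iff_norm, add_sub_cancel_left, not_lt, Set.mem_image]
    constructor
    · intro h
      rw [norm_coe_eq_min_of_mem_Ico hs, le_min_iff] at h
      exact ⟨s, ⟨hs, h.1, by linarith⟩, rfl⟩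
    · rintro ⟨u, ⟨hu, h1, h2⟩, hus⟩
      rw [← add_left_cancel hus, norm_coe_eq_min_of_mem_Ico hu]
      exact le_min h1 (by linarith)
  rw [key]
  exact (Set.ordConnected_Ico.inter Set.ordConnected_Icc).isPreconnected.image _
    (by have := AddCircle.continuous_mk' (1 : ℝ); fun_prop)

theorem sphere_subset (x : Circ) (r : ℝ) :
    Metric.sphere x r ⊆ {x + (r : Circ), x + ((-r : ℝ) : Circ)} := by
  intro z hz
  obtain ⟨s, hs, rfl⟩ := exists_mem_Ico_eq_add x z
  rw [mem_sphere_iff_norm, add_sub_cancel_left, norm_coe_eq_min_of_mem_Ico hs] at hz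
  rcases min_choice s (1 - s) with h | h
  · exact Or.inl (by rw [← hz, h])
  · refine Or.inr ?_
    rw [Set.mem_singleton_iff, show -r = s - 1 by linarith, AddCircle.coe_sub,
      AddCircle.coe_period, sub_zero]

theorem subset_ball_or_compl_subset_ball {C : Set Circ} {x : Circ} {r : ℝ}
    (h : frontier C ⊆ Metric.ball x r) : C ⊆ Metric.ball x r ∨ Cᶜ ⊆ Metric.ball x r := by
  by_contra! hcon
  obtain ⟨⟨y, hyC, hy⟩, ⟨z, hzC, hz⟩⟩ := hcon.imp Set.not_subset.1 Set.not_subset.1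
  obtain ⟨w, hw, hwC⟩ := nonempty_inter_frontier_of_isPreconnected
    (isPreconnected_compl_ball x r) ⟨y, hy, hyC⟩ ⟨z, hz, hzC⟩
  exact hw (h hwC)

theorem exists_ordConnected_image_eq {J : Set Circ} (hJ : IsPreconnected J) (hne : J ≠ Set.univ) :
    ∃ (a : ℝ) (I : Set ℝ), I.OrdConnected ∧ I ⊆ Set.Ico a (a + 1) ∧ ((↑) : ℝ → Circ) '' I = J := by
  obtain ⟨r, hr⟩ := (Set.ne_univ_iff_exists_notMem J).1 hne
  obtain ⟨a, rfl⟩ := QuotientAddGroup.mk_surjective r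
  have hcont : ContinuousOn (fun z : Circ => (AddCircle.equivIco (1 : ℝ) a z : ℝ)) J :=
    fun z hz => (continuous_subtype_val.continuousAt.comp (AddCircle.continuousAt_equivIco 1 a
      (ne_of_mem_of_not_mem hz hr))).continuousWithinAt
  refine ⟨a, _, (hJ.image _ hcont).ordConnected, ?_, ?_⟩
  · rintro _ ⟨z, -, rfl⟩
    exact (AddCircle.equivIco (1 : ℝ) a z).2
  · simp only [Set.image_image, AddCircle.coe_equivIco, Set.image_id']

theorem measurableSet_of_isPreconnected {J : Set Circ} (hJ : IsPreconnected J) :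
    MeasurableSet J := by
  by_cases hne : J = Set.univ
  · exact hne ▸ MeasurableSet.univ
  obtain ⟨a, I, hI, hIa, rfl⟩ := exists_ordConnected_image_eq hJ hne
  refine hI.measurableSet.image_of_continuousOn_injOn
    (AddCircle.continuous_mk' (1 : ℝ)).continuousOn fun s hs t ht h => ?_
  exact (AddCircle.coe_eq_coe_iff_of_mem_Ico (hIa hs) (hIa ht)).1 h

theorem finite_frontier {J : Set Circ} (hJ : IsPreconnected J) : (frontier J).Finite := by
  by_cases hne : J = Set.univ
  · simp [hne]
  obtain ⟨a, I, hI, hIa, rfl⟩ := exists_ordConnected_image_eq hJ hne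
  have hcont : Continuous ((↑) : ℝ → Circ) := AddCircle.continuous_mk' 1
  rcases I.eq_empty_or_nonempty with rfl | hIne
  · simp
  have hbelow : BddBelow I := bddBelow_Ico.mono hIa
  have habove : BddAbove I := bddAbove_Ico.mono hIa
  have hinterior : ((↑) : ℝ → Circ) '' Set.Ioo (sInf I) (sSup I) ⊆ interior ((↑) '' I) :=
    interior_maximal (Set.image_mono
      (IsConnected.Ioo_csInf_csSup_subset ⟨hIne, hI.isPreconnected⟩ hbelow habove))
      (QuotientAddGroup.isOpenMap_coe _ isOpen_Ioo)
  have hclosure : closure ((↑) '' I) ⊆ ((↑) : ℝ → Circ) '' Set.Icc (sInf I) (sSup I) :=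
    closure_minimal (Set.image_mono (subset_Icc_csInf_csSup hbelow habove))
      (isCompact_Icc.image hcont).isClosed
  refine (Set.toFinite {((sInf I : ℝ) : Circ), ((sSup I : ℝ) : Circ)}).subset ?_
  rintro _ ⟨hcl, hint⟩
  obtain ⟨s, hs, rfl⟩ := hclosure hcl
  rcases Set.eq_endpoints_or_mem_Ioo_of_mem_Icc hs with h | h | h
  · exact Or.inl (by rw [h])
  · exact Or.inr (by rw [h]; rfl)
  · exact absurd (hinterior ⟨s, h, rfl⟩) hint

theorem dist_le_volume {J : Set Circ} (hJ : IsPreconnected J) {x y : Circ} (hx : x ∈ J)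
    (hy : y ∈ J) : ENNReal.ofReal (dist x y) ≤ volume J := by
  by_cases hne : J = Set.univ
  · rw [hne, UnitAddCircle.measure_univ, ENNReal.ofReal_le_one, dist_eq_norm]
    have := AddCircle.norm_le_half_period (p := (1 : ℝ)) (x := x - y) one_ne_zero
    norm_num at this
    linarith
  obtain ⟨a, I, hI, hIa, rfl⟩ := exists_ordConnected_image_eq hJ hne
  obtain ⟨s, hs, rfl⟩ := hx
  obtain ⟨t, ht, rfl⟩ := hy
  wlog hst : s ≤ t generalizing s t
  · rw [dist_comm]
    exact this t ht s hs (le_of_not_ge hst)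
  calc ENNReal.ofReal (dist (s : Circ) t) ≤ ENNReal.ofReal (t - s) := by
        refine ENNReal.ofReal_le_ofReal ?_
        rw [dist_comm, dist_eq_norm, ← AddCircle.coe_sub, UnitAddCircle.norm_eq]
        simpa [abs_of_nonneg (sub_nonneg.2 hst)] using round_le (t - s) 0
    _ = volume.restrict (Set.Ioc a (a + 1)) (Set.Ioc s t) := by
        rw [Measure.restrict_eq_self _ (Set.Ioc_subset_Ioc (hIa hs).1 (hIa ht).2.le),
          Real.volume_Ioc]
    _ ≤ volume.restrict (Set.Ioc a (a + 1)) (((↑) : ℝ → Circ) ⁻¹' ((↑) '' I)) :=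
        measure_mono fun u hu => ⟨u, hI.out hs ht (Set.Ioc_subset_Icc_self hu), rfl⟩
    _ ≤ volume (((↑) : ℝ → Circ) '' I) := by
        have h := UnitAddCircle.measurePreserving_mk a
        rw [← h.map_eq]
        exact Measure.le_map_apply h.measurable.aemeasurable _

end Circ

/-! ### Times -/

theorem tendsto_comp_const_add_atTop_iff {M α : Type*} [AddCommMonoid M] [LinearOrder M]
    [IsOrderedAddMonoid M] [CanonicallyOrderedAdd M] {f : M → α} {l : Filter α} (s : M) :
    Tendsto (fun t => f (s + t)) atTop l ↔ Tendsto f atTop l := by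
  refine ⟨fun h S hS => ?_, fun h => h.comp (tendsto_atTop_mono (fun _ => le_add_self) tendsto_id)⟩
  obtain ⟨N, hN⟩ := eventually_atTop.1 (h hS)
  refine eventually_atTop.2 ⟨s + N, fun t ht => ?_⟩
  obtain ⟨u, rfl⟩ := exists_add_of_le ht
  simpa only [add_assoc] using hN (N + u) le_self_add

namespace TimeDomain

variable {k : TimeDomain}

theorem natCast_mem (k : TimeDomain) (n : ℕ) : (n : ℝ≥0) ∈ k.carrier := by
  cases k
  · exact ⟨n, rfl⟩
  · trivial

/-- The natural number `n` as a time. -/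
def natTime (k : TimeDomain) (n : ℕ) : k.Time := ⟨n, k.natCast_mem n⟩

theorem natTime_add (m n : ℕ) : k.natTime (m + n) = k.natTime m + k.natTime n :=
  Subtype.ext (Nat.cast_add m n)

theorem natTime_strictMono : StrictMono k.natTime := fun _ _ h => Nat.cast_lt (α := ℝ≥0).2 h

theorem exists_natTime_ge (t : k.Time) : ∃ n : ℕ, t ≤ k.natTime n :=
  exists_nat_ge (t : ℝ≥0)

theorem tendsto_natTime : Tendsto k.natTime atTop atTop :=
  tendsto_atTop_atTop_of_monotone natTime_strictMono.monotone exists_natTime_ge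

theorem exists_eq_natTime (t : TimeDomain.discrete.Time) : ∃ n, natTime .discrete n = t := by
  obtain ⟨_, n, rfl⟩ := t
  exact ⟨n, rfl⟩

instance : CanonicallyOrderedAdd k.Time where
  le_add_self s t := (le_add_self : (s : ℝ≥0) ≤ t + s)
  le_self_add s t := (le_self_add : (s : ℝ≥0) ≤ s + t)
  exists_add_of_le {s t} h := by
    cases k
    · obtain ⟨m, rfl⟩ := exists_eq_natTime s
      obtain ⟨n, rfl⟩ := exists_eq_natTime t
      exact ⟨natTime _ (n - m), by
        rw [← natTime_add, Nat.add_sub_cancel' (natTime_strictMono.le_iff_le.1 h)]⟩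
    · exact ⟨⟨(t : ℝ≥0) - s, trivial⟩,
        Subtype.ext (add_tsub_cancel_of_le (show (s : ℝ≥0) ≤ t from h)).symm⟩

theorem ceil_div_two_pow_mem (n : ℕ) (t : k.Time) :
    (⌈2 ^ n * (t : ℝ≥0)⌉₊ / 2 ^ n : ℝ≥0) ∈ k.carrier := by
  cases k
  · obtain ⟨_, m, rfl⟩ := t
    refine ⟨m, ?_⟩
    have : (2 ^ n * (m : ℝ≥0)) = ((2 ^ n * m : ℕ) : ℝ≥0) := by push_cast; rfl
    change (m : ℝ≥0) = ⌈2 ^ n * (m : ℝ≥0)⌉₊ / 2 ^ n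
    rw [this, Nat.ceil_natCast, Nat.cast_mul, Nat.cast_pow, Nat.cast_ofNat,
      mul_div_cancel_left₀ _ (by positivity)]
  · trivial

/-- The least multiple of `2⁻ⁿ` that is at least `t`. In discrete time it is `t` itself. These
approximations reduce statements about right-continuous paths to countably many times. -/
noncomputable def dyadicCeil (n : ℕ) (t : k.Time) : k.Time :=
  ⟨⌈2 ^ n * (t : ℝ≥0)⌉₊ / 2 ^ n, ceil_div_two_pow_mem n t⟩

theorem measurable_dyadicCeil (n : ℕ) : Measurable (dyadicCeil (k := k) n) :=
  ((measurable_from_nat.comp (measurable_subtype_coe.const_mul _).nat_ceil).div_const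
    _).subtype_mk

theorem countable_range_dyadicCeil (n : ℕ) : (Set.range (dyadicCeil (k := k) n)).Countable := by
  refine ((Set.countable_range fun m : ℕ => (m / 2 ^ n : ℝ≥0)).preimage
    Subtype.val_injective).mono ?_
  rintro _ ⟨t, rfl⟩
  exact ⟨_, rfl⟩

theorem antitone_dyadicCeil (t : k.Time) : Antitone fun n => dyadicCeil n t := by
  refine antitone_nat_of_succ_le fun n => ?_
  change (⌈2 ^ (n + 1) * (t : ℝ≥0)⌉₊ / 2 ^ (n + 1) : ℝ≥0) ≤ ⌈2 ^ n * (t : ℝ≥0)⌉₊ / 2 ^ n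
  have h : ⌈2 ^ (n + 1) * (t : ℝ≥0)⌉₊ ≤ 2 * ⌈2 ^ n * (t : ℝ≥0)⌉₊ := by
    rw [Nat.ceil_le, pow_succ', mul_assoc, Nat.cast_mul, Nat.cast_ofNat]
    gcongr
    exact Nat.le_ceil _
  calc (⌈2 ^ (n + 1) * (t : ℝ≥0)⌉₊ / 2 ^ (n + 1) : ℝ≥0)
      ≤ (2 * ⌈2 ^ n * (t : ℝ≥0)⌉₊ : ℕ) / 2 ^ (n + 1) := by gcongr
    _ = ⌈2 ^ n * (t : ℝ≥0)⌉₊ / 2 ^ n := by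
        rw [pow_succ', Nat.cast_mul, Nat.cast_ofNat, mul_div_mul_left _ _ two_ne_zero]

theorem tendsto_dyadicCeil (t : k.Time) : Tendsto (fun n => dyadicCeil n t) atTop (𝓝 t) := by
  rw [tendsto_subtype_rng]
  have hupper : Tendsto (fun n : ℕ => (t : ℝ≥0) + (1 / 2 : ℝ≥0) ^ n) atTop (𝓝 (t : ℝ≥0)) := by
    simpa using (tendsto_const_nhds (x := (t : ℝ≥0))).add
      (NNReal.tendsto_pow_atTop_nhds_zero_of_lt_one (r := 1 / 2) (by norm_num))
  refine tendsto_of_tendsto_of_tendsto_of_le_of_le tendsto_const_nhds hupper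
    (fun n => ?_) fun n => ?_
  · change (t : ℝ≥0) ≤ ⌈2 ^ n * (t : ℝ≥0)⌉₊ / 2 ^ n
    rw [le_div_iff₀' (by positivity)]
    exact Nat.le_ceil _
  · change (⌈2 ^ n * (t : ℝ≥0)⌉₊ / 2 ^ n : ℝ≥0) ≤ (t : ℝ≥0) + (1 / 2 : ℝ≥0) ^ n
    rw [div_le_iff₀' (by positivity), mul_add, one_div, inv_pow,
      mul_inv_cancel₀ (by positivity)]
    exact (Nat.ceil_lt_add_one zero_le).le

theorem measurableEmbedding_coe_continuous :
    MeasurableEmbedding (fun t : TimeDomain.continuous.Time => ((t : ℝ≥0) : ℝ)) :=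
  (MeasurableEmbedding.subtype_coe measurableSet_Ici).comp
    (MeasurableEmbedding.subtype_coe MeasurableSet.univ)

theorem timeMeasure_image_add (s : k.Time) (S : Set k.Time) :
    k.timeMeasure ((s + ·) '' S) = k.timeMeasure S := by
  cases k
  · exact Measure.count_injective_image (add_right_injective s) S
  · change Measure.comap _ _ _ = Measure.comap _ _ _
    rw [measurableEmbedding_coe_continuous.comap_apply,
      measurableEmbedding_coe_continuous.comap_apply, Set.image_image]
    change volume ((fun t : TimeDomain.continuous.Time => ((s : ℝ≥0) : ℝ) + ((t : ℝ≥0) : ℝ)) '' S)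
      = _
    rw [← Set.image_image (fun x : ℝ => ((s : ℝ≥0) : ℝ) + x), Set.image_add_left,
      measure_preimage_add]

theorem map_add_timeMeasure (s : k.Time) :
    k.timeMeasure.map (s + ·) = k.timeMeasure.restrict (Set.Ici s) := by
  have hrange : Set.range (s + ·) = Set.Ici s :=
    Set.ext fun t => ⟨by rintro ⟨u, rfl⟩; exact le_self_add (a := s),
      fun h => (exists_add_of_le h).imp fun _ => Eq.symm⟩
  ext S hS
  rw [Measure.map_apply (by fun_prop) hS, Measure.restrict_apply hS, ← hrange,
    ← Set.image_preimage_eq_inter_range, timeMeasure_image_add]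

theorem timeMeasure_Iio_natTime (n : ℕ) : k.timeMeasure (Set.Iio (k.natTime n)) = n := by
  cases k
  · have himage : Set.Iio (natTime .discrete n) = natTime .discrete '' Set.Iio n := by
      ext t
      obtain ⟨m, rfl⟩ := exists_eq_natTime t
      simp [natTime_strictMono.lt_iff_lt, natTime_strictMono.injective.eq_iff]
    rw [himage]
    change Measure.count _ = _
    rw [Measure.count_injective_image natTime_strictMono.injective,
      Measure.count_apply_finite _ (Set.finite_Iio n)]
    simp
  · have himage : (fun t : TimeDomain.continuous.Time => ((t : ℝ≥0) : ℝ)) ''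
        Set.Iio (natTime .continuous n) = Set.Ico 0 (n : ℝ) := by
      ext x
      constructor
      · rintro ⟨t, ht : (t : ℝ≥0) < n, rfl⟩
        exact ⟨NNReal.coe_nonneg _, by exact_mod_cast ht⟩
      · intro h
        exact ⟨⟨⟨x, h.1⟩, trivial⟩, show (⟨x, h.1⟩ : ℝ≥0) < n by exact_mod_cast h.2, rfl⟩
    change Measure.comap _ _ _ = _
    rw [measurableEmbedding_coe_continuous.comap_apply, himage]
    simp

theorem timeMeasure_Ico_add_natTime (s : k.Time) (n : ℕ) :
    k.timeMeasure (Set.Ico s (s + k.natTime n)) = n := by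
  rw [← Set.Ici_inter_Iio, Set.inter_comm, ← Measure.restrict_apply measurableSet_Iio,
    ← map_add_timeMeasure, Measure.map_apply (by fun_prop) measurableSet_Iio,
    ← timeMeasure_Iio_natTime (k := k) n]
  congr 1
  ext t
  exact add_lt_add_iff_left s

end TimeDomain

/-! ### Zero-one law, atoms and measures of images -/

section Measure

theorem measure_setOf_eventually_mem_le {α : Type*} [MeasurableSpace α] {μ : Measure α}
    {A : ℕ → Set α} {c : ℝ≥0∞} (h : ∀ n, μ (A n) ≤ c) :
    μ {x | ∀ᶠ n in atTop, x ∈ A n} ≤ c := by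
  have hmono : Monotone fun N : ℕ => ⋂ n ≥ N, A n := fun _ _ hab =>
    Set.biInter_mono (fun _ hn => hab.trans hn) fun _ _ => le_rfl
  have hset : {x | ∀ᶠ n in atTop, x ∈ A n} = ⋃ N : ℕ, ⋂ n ≥ N, A n := by
    ext x
    simp only [Set.mem_ofPred_eq, eventually_atTop, Set.mem_iUnion, Set.mem_iInter]
  rw [hset, hmono.measure_iUnion]
  exact iSup_le fun N => (measure_mono (Set.biInter_subset_of_mem le_rfl)).trans (h N)

theorem finite_setOf_le_measure_singleton {α : Type*} [MeasurableSpace α]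
    [MeasurableSingletonClass α] (μ : Measure α) [IsFiniteMeasure μ] {ε : ℝ≥0∞} (hε : ε ≠ 0) :
    {y | ε ≤ μ {y}}.Finite :=
  Measure.finite_const_le_meas_of_disjoint_iUnion μ (pos_iff_ne_zero.2 hε)
    (fun _ => measurableSet_singleton _) (fun _ _ h => Set.disjoint_singleton.2 h)
    (measure_ne_top _ _)

theorem exists_forall_measure_singleton_le {α : Type*} [MeasurableSpace α]
    [MeasurableSingletonClass α] (μ : Measure α) [IsFiniteMeasure μ] {x : α} (hx : μ {x} ≠ 0) :
    ∃ p, μ {p} ≠ 0 ∧ ∀ y, μ {y} ≤ μ {p} := by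
  obtain ⟨p, hp, hmax⟩ := Set.exists_max_image _ (fun y => μ {y})
    (finite_setOf_le_measure_singleton μ hx) ⟨x, le_refl (μ {x})⟩
  exact ⟨p, ((pos_iff_ne_zero.2 hx).trans_le hp).ne', fun y =>
    (le_total (μ {x}) (μ {y})).elim (hmax y) fun h => h.trans hp⟩

theorem exists_forall_measure_ball_lt {X : Type*} [PseudoMetricSpace X] [CompactSpace X]
    [MeasurableSpace X] {μ : Measure X} [μ.OuterRegular] {c : ℝ≥0∞} (hμ : ∀ x, μ {x} < c) :
    ∃ δ > 0, ∀ x, μ (Metric.ball x δ) < c := by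
  choose U hxU hU hlt using fun x => Set.exists_isOpen_lt_of_lt {x} c (hμ x)
  obtain ⟨δ, hδ, hsub⟩ := lebesgue_number_lemma_of_metric (isCompact_univ (X := X)) hU
    fun x _ => Set.mem_iUnion.2 ⟨x, hxU x rfl⟩
  refine ⟨δ, hδ, fun x => ?_⟩
  obtain ⟨y, hy⟩ := hsub x trivial
  exact (measure_mono hy).trans_lt (hlt y)

theorem measure_eq_zero_or_one_of_forall_measure_inter_eq_mul {Ω ι : Type*} [SemilatticeSup ι]
    {mΩ : MeasurableSpace Ω} {P : Measure Ω} [IsProbabilityMeasure P] {ℱ : Filtration ι mΩ}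
    {S : Set Ω} (hS : MeasurableSet[⨆ i, ℱ i] S)
    (h : ∀ i A, MeasurableSet[ℱ i] A → P (A ∩ S) = P A * P S) : P S = 0 ∨ P S = 1 := by
  have hle : MeasurableSpace.generateFrom {S} ≤ mΩ :=
    MeasurableSpace.generateFrom_le (by rintro _ rfl; exact iSup_le ℱ.le _ hS)
  have hindep : ∀ i, Indep (ℱ i) (MeasurableSpace.generateFrom {S}) P := fun i => by
    refine IndepSets.indep (ℱ.le i) hle (@MeasurableSpace.isPiSystem_measurableSet _ (ℱ i))
      (IsPiSystem.singleton S) (@MeasurableSpace.generateFrom_measurableSet _ (ℱ i)).symm rfl ?_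
    rw [IndepSets_iff]
    rintro A _ hA rfl
    exact h i A hA
  exact measure_eq_zero_or_one_of_indepSet_self
    ((indep_iSup_of_monotone hindep ℱ.le hle fun _ _ h => ℱ.mono h).indepSet_of_measurableSet hS
      (MeasurableSpace.measurableSet_generateFrom rfl))

end Measure

section MeasurableImage

variable {α X Y : Type*} [MeasurableSpace α] [PseudoMetricSpace X]
  [TopologicalSpace.SeparableSpace X] [PseudoMetricSpace Y] [SecondCountableTopology Y]
  [MeasurableSpace Y] [OpensMeasurableSpace Y] {f : α → X ≃ₜ Y}

theorem measurable_measure_image_of_isClosed (μ : Measure Y) [SFinite μ]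
    (hf : ∀ x, Measurable fun a => f a x) {K : Set X} (hK : IsClosed K) :
    Measurable fun a => μ (f a '' K) := by
  obtain ⟨D, hDK, hD, hKD⟩ :=
    (TopologicalSpace.IsSeparable.of_separableSpace K).exists_countable_dense_subset
  have hclosure : closure D = K := (closure_minimal hDK hK).antisymm hKD
  have hmem : {p : α × Y | p.2 ∈ f p.1 '' K} =
      ⋂ n : ℕ, ⋃ d ∈ D, {p | dist p.2 (f p.1 d) < 1 / ((n : ℝ) + 1)} := by
    ext ⟨a, z⟩
    rw [Set.mem_ofPred_eq, ← hclosure, (f a).image_closure,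
      mem_closure_iff_nhds_basis Metric.nhds_basis_ball_inv_nat_succ]
    simp [dist_comm]
  refine measurable_measure_prodMk_left (s := {p : α × Y | p.2 ∈ f p.1 '' K}) ?_
  rw [hmem]
  exact MeasurableSet.iInter fun n => MeasurableSet.biUnion hD fun d _ =>
    measurableSet_lt (measurable_snd.dist ((hf d).comp measurable_fst)) measurable_const

theorem measurable_measure_image_of_isOpen (μ : Measure Y) [IsFiniteMeasure μ]
    (hf : ∀ x, Measurable fun a => f a x) {U : Set X} (hU : IsOpen U) :
    Measurable fun a => μ (f a '' U) := by
  have hcompl : ∀ a, μ (f a '' U) = μ Set.univ - μ (f a '' Uᶜ) := fun a => by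
    rw [← measure_compl ((f a).isClosedMap _ hU.isClosed_compl).measurableSet (measure_ne_top _ _),
      Set.image_compl_eq (f a).bijective, compl_compl]
  simp only [hcompl]
  exact measurable_const.sub (measurable_measure_image_of_isClosed μ hf hU.isClosed_compl)

end MeasurableImage

/-! ### Crack points -/

section CrackPoint

variable {k : TimeDomain} {Ω : Type*} {φ : k.Time → Ω → (Circ ≃ₜ Circ)} {ω : Ω}

/-- The length of the image of `S` tends to zero. -/
def IsContracted (φ : k.Time → Ω → (Circ ≃ₜ Circ)) (ω : Ω) (S : Set Circ) : Prop :=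
  Tendsto (fun t => volume (φ t ω '' S)) atTop (𝓝 0)

theorem IsContracted.mono {S T : Set Circ} (h : IsContracted φ ω T) (hST : S ⊆ T) :
    IsContracted φ ω S :=
  tendsto_of_tendsto_of_tendsto_of_le_of_le tendsto_const_nhds h (fun _ => zero_le)
    fun _ => measure_mono (Set.image_mono hST)

theorem IsContracted.biUnion {ι : Type*} {s : Finset ι} {B : ι → Set Circ}
    (h : ∀ i ∈ s, IsContracted φ ω (B i)) : IsContracted φ ω (⋃ i ∈ s, B i) := by
  have hsum := tendsto_finsetSum s h
  rw [Finset.sum_const_zero] at hsum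
  refine tendsto_of_tendsto_of_tendsto_of_le_of_le tendsto_const_nhds hsum (fun _ => zero_le)
    fun t => ?_
  rw [Set.image_iUnion₂]
  exact measure_biUnion_finset_le _ _

theorem not_isContracted_univ : ¬ IsContracted φ ω Set.univ := fun h => by
  simp [IsContracted, Set.image_univ, (φ _ ω).surjective.range_eq] at h

theorem IsContracted.not_compl {S : Set Circ} (h : IsContracted φ ω S) :
    ¬ IsContracted φ ω Sᶜ := fun h' => by
  have hunion := IsContracted.biUnion (s := .univ) (B := fun b => bif b then S else Sᶜ)
    fun b _ => b.rec h' h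
  refine not_isContracted_univ (hunion.mono fun z _ => ?_)
  by_cases hz : z ∈ S <;> simp [hz]

theorem IsContracted.synced {S : Set Circ} (h : IsContracted φ ω S) (hS : IsPreconnected S)
    {x y : Circ} (hx : x ∈ S) (hy : y ∈ S) : Synced φ ω x y := by
  have hle : ∀ t, ENNReal.ofReal (dist (φ t ω x) (φ t ω y)) ≤ volume (φ t ω '' S) := fun t =>
    Circ.dist_le_volume (hS.image _ (φ t ω).continuous.continuousOn)
      (Set.mem_image_of_mem _ hx) (Set.mem_image_of_mem _ hy)
  have hlim := (ENNReal.tendsto_toReal ENNReal.zero_ne_top).comp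
    (tendsto_of_tendsto_of_tendsto_of_le_of_le tendsto_const_nhds h (fun _ => zero_le) hle)
  exact hlim.congr fun t => ENNReal.toReal_ofReal dist_nonneg

theorem Synced.symm {x y : Circ} (h : Synced φ ω x y) : Synced φ ω y x := by
  simpa only [Synced, dist_comm] using h

theorem Synced.trans {x y z : Circ} (hxy : Synced φ ω x y) (hyz : Synced φ ω y z) :
    Synced φ ω x z :=
  squeeze_zero (fun _ => dist_nonneg) (fun _ => dist_triangle _ _ _)
    (by simpa only [add_zero] using Tendsto.add hxy hyz)

theorem IsCrackPoint.isContracted_compl {r : Circ} (h : IsCrackPoint φ ω r) {U : Set Circ}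
    (hU : IsOpen U) (hr : r ∈ U) : IsContracted φ ω Uᶜ :=
  h Uᶜ hU.isClosed_compl fun hr' => hr' hr

theorem IsCrackPoint.synced {r x y : Circ} (h : IsCrackPoint φ ω r) (hx : x ≠ r) (hy : y ≠ r) :
    Synced φ ω x y := by
  have hpos : 0 < min (dist x r) (dist y r) := lt_min (dist_pos.2 hx) (dist_pos.2 hy)
  exact (h.isContracted_compl Metric.isOpen_ball (Metric.mem_ball_self hpos)).synced
    (Circ.isPreconnected_compl_ball r _)
    (by simp) (by simp)

theorem IsCrackPoint.isRepulsiveCrackPoint {r y : Circ} (h : IsCrackPoint φ ω r)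
    (hy : y ≠ r) (hyr : ¬ Synced φ ω y r) : IsRepulsiveCrackPoint φ ω r := by
  have hnot : ∀ x, x ≠ r → ¬ Synced φ ω x r := fun x hx hxr => hyr ((h.synced hy hx).trans hxr)
  refine ⟨h, fun x z => ?_⟩
  rcases eq_or_ne x r with rfl | hx
  · rcases eq_or_ne z x with rfl | hz
    · simp only [Synced, dist_self, tendsto_const_nhds]
    · simpa only [hz, true_iff, not_true, iff_false] using fun h => hnot z hz (Synced.symm h)
  · rcases eq_or_ne z r with rfl | hz
    · simpa only [hx, false_iff, not_true, iff_false] using hnot x hx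
    · simpa only [hx, hz, iff_self, iff_true] using h.synced hx hz

/-- A countable family of closed balls whose interiors form a basis of the topology. -/
noncomputable def denseBall (j n : ℕ) : Set Circ :=
  Metric.closedBall (TopologicalSpace.denseSeq Circ j) (1 / ((n : ℝ) + 1))

theorem isClosed_denseBall (j n : ℕ) : IsClosed (denseBall j n) := Metric.isClosed_closedBall

theorem exists_mem_interior_denseBall (x : Circ) (n : ℕ) : ∃ j, x ∈ interior (denseBall j n) := by
  obtain ⟨j, hj⟩ := (TopologicalSpace.denseRange_denseSeq Circ).exists_dist_lt x
    (Nat.one_div_pos_of_nat (n := n) (α := ℝ))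
  exact ⟨j, Metric.ball_subset_interior_closedBall hj⟩

theorem exists_forall_denseBall_subset {U : Set Circ} (hU : IsOpen U) {x : Circ} (hx : x ∈ U) :
    ∃ n, ∀ j, x ∈ denseBall j n → denseBall j n ⊆ U := by
  obtain ⟨ε, hε, hball⟩ := Metric.isOpen_iff.1 hU x hx
  obtain ⟨n, hn⟩ := exists_nat_one_div_lt (half_pos hε)
  refine ⟨n, fun j hxj z hz => hball ?_⟩
  have := dist_triangle_right z x (TopologicalSpace.denseSeq Circ j)
  rw [denseBall, Metric.mem_closedBall] at hxj hz
  rw [Metric.mem_ball]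
  linarith

theorem IsCrackPoint.exists_isContracted_compl_denseBall {r : Circ} (h : IsCrackPoint φ ω r)
    (n : ℕ) : ∃ j, r ∈ denseBall j n ∧ IsContracted φ ω (denseBall j n)ᶜ := by
  obtain ⟨j, hj⟩ := exists_mem_interior_denseBall r n
  exact ⟨j, interior_subset hj, (h.isContracted_compl isOpen_interior hj).mono
    (Set.compl_subset_compl.2 interior_subset)⟩

theorem isCrackPoint_of_forall_isContracted_compl {j : ℕ → ℕ}
    (h : ∀ n, IsContracted φ ω (denseBall (j n) n)ᶜ) {r : Circ} (hr : ∀ n, r ∈ denseBall (j n) n) :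
    IsCrackPoint φ ω r := fun G hG hrG => by
  obtain ⟨n, hn⟩ := exists_forall_denseBall_subset hG.isOpen_compl hrG
  exact (h n).mono (Set.subset_compl_comm.1 (hn (j n) (hr n)))

theorem mem_contractiveSet_iff :
    ω ∈ contractiveSet φ ↔ ∀ n : ℕ, ∃ j : ℕ, IsContracted φ ω (denseBall j n)ᶜ := by
  refine ⟨fun ⟨r, hr⟩ n => ?_, fun h => ?_⟩
  · obtain ⟨j, -, hj⟩ := hr.exists_isContracted_compl_denseBall n
    exact ⟨j, hj⟩
  choose j hj using h
  obtain ⟨r, hr⟩ : (⋂ n, denseBall (j n) n).Nonempty := by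
    refine CompactSpace.iInter_nonempty (fun n => isClosed_denseBall _ _) fun s => ?_
    by_contra hempty
    have hcover : ⋃ n ∈ s, (denseBall (j n) n)ᶜ = Set.univ := by
      rw [← Set.compl_iInter₂, Set.not_nonempty_iff_eq_empty.1 hempty, Set.compl_empty]
    exact not_isContracted_univ (hcover ▸ IsContracted.biUnion fun n _ => hj n)
  exact ⟨r, isCrackPoint_of_forall_isContracted_compl hj (Set.mem_iInter.1 hr)⟩

theorem IsCrackPoint.mem_iff_exists_denseBall {r : Circ} (h : IsCrackPoint φ ω r) {U : Set Circ}
    (hU : IsOpen U) :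
    r ∈ U ↔ ∃ p : ℕ × ℕ, denseBall p.1 p.2 ⊆ U ∧ IsContracted φ ω (denseBall p.1 p.2)ᶜ := by
  refine ⟨fun hr => ?_, fun ⟨p, hpU, hp⟩ => hpU (by_contra fun hr => ?_)⟩
  · obtain ⟨n, hn⟩ := exists_forall_denseBall_subset hU hr
    obtain ⟨j, hrj, hj⟩ := h.exists_isContracted_compl_denseBall n
    exact ⟨(j, n), hn j hrj, hj⟩
  · exact IsContracted.not_compl (h _ (isClosed_denseBall _ _) hr) hp

open Classical in
/-- The crack point as a function on the whole sample space, with the junk value `0` at the sample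
points that are not contractive. -/
noncomputable def crackFun (φ : k.Time → Ω → (Circ ≃ₜ Circ)) (ω : Ω) : Circ :=
  if h : ω ∈ contractiveSet φ then crackPoint φ ⟨ω, h⟩ else 0

theorem crackFun_of_mem (h : ω ∈ contractiveSet φ) : crackFun φ ω = crackPoint φ ⟨ω, h⟩ :=
  dif_pos h

theorem crackFun_of_notMem (h : ω ∉ contractiveSet φ) : crackFun φ ω = 0 := dif_neg h

theorem isCrackPoint_crackFun (h : ω ∈ contractiveSet φ) : IsCrackPoint φ ω (crackFun φ ω) := by
  rw [crackFun_of_mem h]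
  exact h.choose_spec

theorem crackEvent_eq (x : Circ) : crackEvent φ x = contractiveSet φ ∩ crackFun φ ⁻¹' {x} :=
  Set.ext fun _ => ⟨fun ⟨h, hx⟩ => ⟨h, (crackFun_of_mem h).trans hx⟩,
    fun ⟨h, hx⟩ => ⟨h, (crackFun_of_mem h).symm.trans hx⟩⟩

end CrackPoint

/-! ### Measurability -/

section RDS

variable {k : TimeDomain} {Ω : Type*} [mΩ : MeasurableSpace Ω] {P : Measure Ω}
  {ℱ : Filtration k.Time mΩ} {θ : k.Time → Ω → Ω} {φ : k.Time → Ω → (Circ ≃ₜ Circ)}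

theorem futureSigma_le (ℱ : Filtration k.Time mΩ) : futureSigma ℱ ≤ mΩ :=
  iSup_le ℱ.le

theorem le_futureSigma (ℱ : Filtration k.Time mΩ) (t : k.Time) : ℱ t ≤ futureSigma ℱ :=
  le_iSup (fun t => (ℱ t : MeasurableSpace Ω)) t

namespace IsRDS

theorem measurable_future (hφ : IsRDS ℱ θ φ) (t : k.Time) :
    Measurable[(futureSigma ℱ).prod (inferInstance : MeasurableSpace Circ)]
      (fun p : Ω × Circ => φ t p.1 p.2) :=
  (hφ.measurable t).mono (sup_le_sup (MeasurableSpace.comap_mono (le_futureSigma ℱ t)) le_rfl)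
    le_rfl

theorem measurable_uncurry (hφ : IsRDS ℱ θ φ) (t : k.Time) :
    Measurable (fun p : Ω × Circ => φ t p.1 p.2) :=
  (hφ.measurable t).mono (sup_le_sup (MeasurableSpace.comap_mono (ℱ.le t)) le_rfl) le_rfl

theorem measurable_apply_past (hφ : IsRDS ℱ θ φ) (t : k.Time) (x : Circ) :
    Measurable[ℱ t] fun ω => φ t ω x :=
  (hφ.measurable t).comp (@measurable_prodMk_right _ _ (ℱ t) _ x)

theorem measurable_apply (hφ : IsRDS ℱ θ φ) (t : k.Time) (x : Circ) :
    Measurable fun ω => φ t ω x :=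
  (hφ.measurable_apply_past t x).mono (ℱ.le t) le_rfl

theorem tendsto_dyadicCeil (hφ : IsRDS ℱ θ φ) (t : k.Time) (ω : Ω) (x : Circ) :
    Tendsto (fun n => φ (TimeDomain.dyadicCeil n t) ω x) atTop (𝓝 (φ t ω x)) :=
  hφ.right_continuous _ t _ x (TimeDomain.antitone_dyadicCeil t)
    (TimeDomain.tendsto_dyadicCeil t) tendsto_const_nhds ω

theorem tendsto_symm_apply (hφ : IsRDS ℱ θ φ) {u : ℕ → k.Time} {t : k.Time} (hu : Antitone u)
    (hut : Tendsto u atTop (𝓝 t)) (ω : Ω) (x : Circ) :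
    Tendsto (fun n => (φ (u n) ω).symm (φ t ω x)) atTop (𝓝 x) := by
  refine le_nhds_of_unique_clusterPt fun y hy => ?_
  obtain ⟨σ, hσ, hy⟩ := MapClusterPt.tendsto_subseq hy
  have hlim := hφ.right_continuous _ t _ y (hu.comp_monotone hσ.monotone)
    (hut.comp hσ.tendsto_atTop) hy ω
  simp only [Function.comp_apply, Homeomorph.apply_symm_apply] at hlim
  exact (φ t ω).injective (tendsto_nhds_unique hlim tendsto_const_nhds)

theorem volume_image_le_of_antitone (hφ : IsRDS ℱ θ φ) {u : ℕ → k.Time} {t : k.Time}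
    (hu : Antitone u) (hut : Tendsto u atTop (𝓝 t)) (ω : Ω) {U : Set Circ} (hU : IsOpen U)
    {c : ℝ≥0∞} (hc : ∀ n, volume (φ (u n) ω '' U) ≤ c) : volume (φ t ω '' U) ≤ c := by
  refine (measure_mono ?_).trans (measure_setOf_eventually_mem_le hc)
  rintro _ ⟨x, hx, rfl⟩
  exact ((hφ.tendsto_symm_apply hu hut ω x).eventually_mem (hU.mem_nhds hx)).mono fun n hn =>
    ⟨_, hn, (φ (u n) ω).apply_symm_apply _⟩

theorem isContracted_iff_forall_dyadicCeil (hφ : IsRDS ℱ θ φ) {ω : Ω} {U : Set Circ}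
    (hU : IsOpen U) {ε : ℕ → ℝ≥0∞} (hε : ∀ m, 0 < ε m) (hε0 : Tendsto ε atTop (𝓝 0)) :
    IsContracted φ ω U ↔ ∀ m, ∃ N, ∀ n, ∀ d ∈ Set.range (TimeDomain.dyadicCeil (k := k) n),
      k.natTime N ≤ d → volume (φ d ω '' U) ≤ ε m := by
  rw [IsContracted, ENNReal.tendsto_atTop_zero]
  refine ⟨fun h m => ?_, fun h δ hδ => ?_⟩
  · obtain ⟨s, hs⟩ := h (ε m) (hε m)
    obtain ⟨N, hN⟩ := TimeDomain.exists_natTime_ge s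
    exact ⟨N, fun _ d _ hd => hs d (hN.trans hd)⟩
  · obtain ⟨m, hm⟩ := (hε0.eventually_le_const hδ).exists
    obtain ⟨N, hN⟩ := h m
    refine ⟨k.natTime N, fun t ht => (hφ.volume_image_le_of_antitone
      (TimeDomain.antitone_dyadicCeil t) (TimeDomain.tendsto_dyadicCeil t) ω hU fun n =>
        hN n _ ⟨t, rfl⟩ (ht.trans ?_)).trans hm⟩
    exact (TimeDomain.antitone_dyadicCeil t).le_of_tendsto (TimeDomain.tendsto_dyadicCeil t) n

theorem measurableSet_isContracted (hφ : IsRDS ℱ θ φ) {U : Set Circ} (hU : IsOpen U) :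
    MeasurableSet[futureSigma ℱ] {ω | IsContracted φ ω U} := by
  obtain ⟨ε, -, hε, hε0⟩ := exists_seq_strictAnti_tendsto' (zero_lt_one (α := ℝ≥0∞))
  simp only [hφ.isContracted_iff_forall_dyadicCeil hU (fun m => (hε m).1) hε0,
    Set.ofPred_forall, Set.ofPred_exists]
  refine .iInter fun m => .iUnion fun N => .iInter fun n =>
    .biInter (TimeDomain.countable_range_dyadicCeil n) fun d _ => .iInter fun _ => ?_
  exact le_futureSigma ℱ d _ (@measurable_measure_image_of_isOpen _ _ _ (ℱ d) _ _ _ _ _ _ _ _ _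
    (fun x => hφ.measurable_apply_past d x) _ hU _ measurableSet_Iic)

theorem measurableSet_contractiveSet (hφ : IsRDS ℱ θ φ) :
    MeasurableSet[futureSigma ℱ] (contractiveSet φ) := by
  have heq : contractiveSet φ = ⋂ n : ℕ, ⋃ j : ℕ, {ω | IsContracted φ ω (denseBall j n)ᶜ} := by
    ext ω
    simp only [mem_contractiveSet_iff, Set.mem_iInter, Set.mem_iUnion, Set.mem_ofPred_eq]
  rw [heq]
  exact .iInter fun n => .iUnion fun j =>
    hφ.measurableSet_isContracted (isClosed_denseBall j n).isOpen_compl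

theorem measurable_crackFun_future (hφ : IsRDS ℱ θ φ) :
    Measurable[futureSigma ℱ] (crackFun φ) := by
  refine @measurable_of_isOpen _ _ _ _ _ (futureSigma ℱ) _ fun U hU => ?_
  have hset : crackFun φ ⁻¹' U = (contractiveSet φ).ite
      (⋃ p ∈ {p : ℕ × ℕ | denseBall p.1 p.2 ⊆ U}, {ω | IsContracted φ ω (denseBall p.1 p.2)ᶜ})
      {_ω | (0 : Circ) ∈ U} := by
    ext ω
    by_cases hω : ω ∈ contractiveSet φ
    · simp [Set.ite, hω, (isCrackPoint_crackFun hω).mem_iff_exists_denseBall hU]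
    · simp [Set.ite, hω, crackFun_of_notMem hω]
  rw [hset]
  exact hφ.measurableSet_contractiveSet.ite
    (.biUnion (Set.to_countable _) fun p _ =>
      hφ.measurableSet_isContracted (isClosed_denseBall _ _).isOpen_compl)
    (@MeasurableSet.const _ (futureSigma ℱ) _)

theorem measurable_crackFun (hφ : IsRDS ℱ θ φ) : Measurable (crackFun φ) :=
  hφ.measurable_crackFun_future.mono (futureSigma_le ℱ) le_rfl

theorem isContracted_shift_iff (hφ : IsRDS ℱ θ φ) (s : k.Time) (ω : Ω) (S : Set Circ) :
    IsContracted φ (θ s ω) (φ s ω '' S) ↔ IsContracted φ ω S := by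
  rw [IsContracted, IsContracted,
    ← tendsto_comp_const_add_atTop_iff (f := fun t => volume (φ t ω '' S)) s]
  simp only [Set.image_image, hφ.cocycle]

theorem isCrackPoint_shift_iff (hφ : IsRDS ℱ θ φ) (s : k.Time) (ω : Ω) (r : Circ) :
    IsCrackPoint φ (θ s ω) (φ s ω r) ↔ IsCrackPoint φ ω r := by
  refine ⟨fun h G hG hr => ?_, fun h G hG hr => ?_⟩
  · exact (hφ.isContracted_shift_iff s ω G).1 (h _ ((φ s ω).isClosedMap G hG)
      (by rwa [(φ s ω).injective.mem_set_image]))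
  · have := (hφ.isContracted_shift_iff s ω (φ s ω ⁻¹' G)).2
      (h _ (hG.preimage (φ s ω).continuous) hr)
    rwa [Set.image_preimage_eq _ (φ s ω).surjective] at this

theorem shift_mem_contractiveSet_iff (hφ : IsRDS ℱ θ φ) (s : k.Time) (ω : Ω) :
    θ s ω ∈ contractiveSet φ ↔ ω ∈ contractiveSet φ :=
  ((φ s ω).surjective.exists (p := IsCrackPoint φ (θ s ω))).trans
    (exists_congr (hφ.isCrackPoint_shift_iff s ω))

theorem crackFun_shift (hφ : IsRDS ℱ θ φ) (s : k.Time) {ω : Ω} (hω : ω ∈ contractiveSet φ) :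
    crackFun φ (θ s ω) = φ s ω (crackFun φ ω) :=
  (isCrackPoint_crackFun ((hφ.shift_mem_contractiveSet_iff s ω).2 hω)).unique
    ((hφ.isCrackPoint_shift_iff s ω _).2 (isCrackPoint_crackFun hω))

theorem isDetFixedPoint_of_forall_ae (hφ : IsRDS ℱ θ φ) {p : Circ}
    (h : ∀ t, ∀ᵐ ω ∂P, φ t ω p = p) : IsDetFixedPoint P φ p := by
  have hdyadic : ∀ᵐ ω ∂P, ∀ n, ∀ d ∈ Set.range (TimeDomain.dyadicCeil (k := k) n), φ d ω p = p :=
    ae_all_iff.2 fun n => (ae_ball_iff (TimeDomain.countable_range_dyadicCeil n)).2 fun d _ => h d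
  filter_upwards [hdyadic] with ω hω t
  refine tendsto_nhds_unique (hφ.tendsto_dyadicCeil t ω p) ?_
  simp only [hω _ _ ⟨t, rfl⟩, tendsto_const_nhds]

end IsRDS

end RDS

/-! ### Independence of the future noise -/

section IndepFun

variable {Ω Ω' α β : Type*} {mΩ : MeasurableSpace Ω} {mΩ' : MeasurableSpace Ω'}
  {mα : MeasurableSpace α} {mβ : MeasurableSpace β} {μ : Measure Ω} {ν : Measure Ω'}
  [IsFiniteMeasure μ] [IsFiniteMeasure ν] {X : Ω → α} {Y : Ω → β} {Z : Ω' → β}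

theorem lintegral_comp_prodMk_of_indepFun (hXY : IndepFun X Y μ) (hX : Measurable X)
    (hY : Measurable Y) (hZ : Measurable Z) (hYZ : μ.map Y = ν.map Z) {G : α × β → ℝ≥0∞}
    (hG : Measurable G) :
    ∫⁻ ω, G (X ω, Y ω) ∂μ = ∫⁻ ω, ∫⁻ ω', G (X ω, Z ω') ∂ν ∂μ := by
  have hmap := (indepFun_iff_map_prod_eq_prod_map_map hX.aemeasurable hY.aemeasurable).1 hXY
  rw [← lintegral_map hG (hX.prodMk hY), hmap, hYZ, lintegral_prod _ hG.aemeasurable,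
    lintegral_map hG.lintegral_prod_right' hX]
  exact lintegral_congr fun ω => lintegral_map (hG.comp measurable_prodMk_left) hZ

theorem measure_prodMk_mem_of_indepFun (hXY : IndepFun X Y μ) (hX : Measurable X)
    (hY : Measurable Y) (hZ : Measurable Z) (hYZ : μ.map Y = ν.map Z) {S : Set (α × β)}
    (hS : MeasurableSet S) :
    μ {ω | (X ω, Y ω) ∈ S} = ∫⁻ ω, ν {ω' | (X ω, Z ω') ∈ S} ∂μ := by
  refine (lintegral_indicator_one (hX.prodMk hY hS)).symm.trans ?_
  refine (lintegral_comp_prodMk_of_indepFun hXY hX hY hZ hYZ (measurable_one.indicator hS)).trans ?_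
  exact lintegral_congr fun ω => lintegral_indicator_one ((measurable_const.prodMk hZ) hS)

theorem integral_comp_prodMk_of_indepFun (hXY : IndepFun X Y μ) (hX : Measurable X)
    (hY : Measurable Y) (hZ : Measurable Z) (hYZ : μ.map Y = ν.map Z) {G : α × β → ℝ}
    (hG : Measurable G) (hint : Integrable (fun ω => G (X ω, Y ω)) μ) :
    ∫ ω, G (X ω, Y ω) ∂μ = ∫ ω, ∫ ω', G (X ω, Z ω') ∂ν ∂μ := by
  have hmap := (indepFun_iff_map_prod_eq_prod_map_map hX.aemeasurable hY.aemeasurable).1 hXY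
  have hint' := (integrable_map_measure hG.aestronglyMeasurable
    (hX.prodMk hY).aemeasurable).2 hint
  rw [hmap, hYZ] at hint'
  rw [← integral_map (hX.prodMk hY).aemeasurable hG.aestronglyMeasurable, hmap, hYZ,
    integral_prod _ hint', integral_map hX.aemeasurable
      hG.stronglyMeasurable.integral_prod_right'.aestronglyMeasurable]
  exact integral_congr_ae (.of_forall fun ω =>
    integral_map hZ.aemeasurable (hG.comp measurable_prodMk_left).aestronglyMeasurable)

end IndepFun

section Noise

variable {k : TimeDomain} {Ω : Type*} [mΩ : MeasurableSpace Ω] {P : Measure Ω}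
  {ℱ : Filtration k.Time mΩ} {θ : k.Time → Ω → Ω}

namespace IsNoise

theorem measurable_shift_future (hθ : IsNoise P ℱ θ) (s : k.Time) :
    Measurable[mΩ, futureSigma ℱ] (θ s) :=
  (hθ.measurePreserving s).measurable.mono le_rfl (futureSigma_le ℱ)

theorem map_shift_future (hθ : IsNoise P ℱ θ) (s : k.Time) :
    @Measure.map Ω Ω mΩ (futureSigma ℱ) (θ s) P = @Measure.map Ω Ω mΩ (futureSigma ℱ) id P := by
  refine @Measure.ext _ (futureSigma ℱ) _ _ fun A hA => ?_
  rw [Measure.map_apply (hθ.measurable_shift_future s) hA,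
    Measure.map_apply (measurable_id'' (futureSigma_le ℱ)) hA, Set.preimage_id,
    (hθ.measurePreserving s).measure_preimage (futureSigma_le ℱ _ hA).nullMeasurableSet]

theorem indepFun_id_shift (hθ : IsNoise P ℱ θ) (s : k.Time) :
    @IndepFun Ω Ω Ω mΩ (ℱ s) (futureSigma ℱ) id (θ s) P := by
  rw [@IndepFun_iff_Indep, MeasurableSpace.comap_id]
  exact hθ.indep s

theorem measure_shift [IsFiniteMeasure P] (hθ : IsNoise P ℱ θ) (s : k.Time) {S : Set (Ω × Ω)}
    (hS : MeasurableSet[(ℱ s : MeasurableSpace Ω).prod (futureSigma ℱ)] S) :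
    P {ω | (ω, θ s ω) ∈ S} = ∫⁻ ω, P {ω' | (ω, ω') ∈ S} ∂P :=
  measure_prodMk_mem_of_indepFun (hθ.indepFun_id_shift s) (measurable_id'' (ℱ.le s))
    (hθ.measurable_shift_future s) (measurable_id'' (futureSigma_le ℱ)) (hθ.map_shift_future s) hS

theorem integral_shift [IsFiniteMeasure P] (hθ : IsNoise P ℱ θ) (s : k.Time) {G : Ω × Ω → ℝ}
    (hG : Measurable[(ℱ s : MeasurableSpace Ω).prod (futureSigma ℱ)] G)
    (hint : Integrable (fun ω => G (ω, θ s ω)) P) :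
    ∫ ω, G (ω, θ s ω) ∂P = ∫ ω, ∫ ω', G (ω, ω') ∂P ∂P :=
  integral_comp_prodMk_of_indepFun (hθ.indepFun_id_shift s) (measurable_id'' (ℱ.le s))
    (hθ.measurable_shift_future s) (measurable_id'' (futureSigma_le ℱ)) (hθ.map_shift_future s) hG
    hint

end IsNoise

end Noise

/-! ### The law of the crack point -/

section CrackPointLaw

variable {k : TimeDomain} {Ω : Type*} [mΩ : MeasurableSpace Ω] {P : Measure Ω}
  {ℱ : Filtration k.Time mΩ} {θ : k.Time → Ω → Ω} {φ : k.Time → Ω → (Circ ≃ₜ Circ)}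

theorem IsNoise.measure_setOf_eventually_shift_mem_le [IsProbabilityMeasure P]
    (hθ : IsNoise P ℱ θ) {s : ℕ → k.Time} {S : ℕ → Set (Ω × Ω)}
    (hS : ∀ n, MeasurableSet[(ℱ (s n) : MeasurableSpace Ω).prod (futureSigma ℱ)] (S n))
    {c : ℝ≥0∞} (h : ∀ n ω, P {ω' | (ω, ω') ∈ S n} ≤ c) :
    P {ω | ∀ᶠ n in atTop, (ω, θ (s n) ω) ∈ S n} ≤ c := by
  refine measure_setOf_eventually_mem_le (A := fun n => {ω | (ω, θ (s n) ω) ∈ S n}) fun n => ?_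
  rw [hθ.measure_shift (s n) (hS n)]
  simpa using lintegral_mono (μ := P) (h n)

namespace IsRDS

theorem measurable_apply_crackFun (hφ : IsRDS ℱ θ φ) (s : k.Time) (x : Circ) :
    Measurable[(ℱ s : MeasurableSpace Ω).prod (futureSigma ℱ)]
      fun p : Ω × Ω => (φ s p.1 x, crackFun φ p.2) :=
  .prodMk ((hφ.measurable_apply_past s x).comp (@measurable_fst _ _ (ℱ s) (futureSigma ℱ)))
    (hφ.measurable_crackFun_future.comp (@measurable_snd _ _ (ℱ s) (futureSigma ℱ)))

theorem map_crackFun_apply (hφ : IsRDS ℱ θ φ) {A : Set Circ} (hA : MeasurableSet A) :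
    P.map (crackFun φ) A = P {ω | crackFun φ ω ∈ A} :=
  Measure.map_apply hφ.measurable_crackFun hA

theorem measure_crackEvent (hφ : IsRDS ℱ θ φ) (hc : ∀ᵐ ω ∂P, ω ∈ contractiveSet φ) (x : Circ) :
    P (crackEvent φ x) = P.map (crackFun φ) {x} := by
  rw [crackEvent_eq, hφ.map_crackFun_apply (measurableSet_singleton x),
    Set.inter_comm, measure_inter_conull (t := contractiveSet φ) hc]
  rfl

theorem measure_contractiveSet_eq_zero_or_one [IsProbabilityMeasure P] (hθ : IsNoise P ℱ θ)
    (hφ : IsRDS ℱ θ φ) : P (contractiveSet φ) = 0 ∨ P (contractiveSet φ) = 1 :=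
  measure_eq_zero_or_one_of_forall_measure_inter_eq_mul hφ.measurableSet_contractiveSet
    fun t A hA => (Indep_iff _ _ _).1 (hθ.indep t) A _ hA
      ⟨_, hφ.measurableSet_contractiveSet, Set.ext (hφ.shift_mem_contractiveSet_iff t)⟩

theorem measure_inter_crackFun_preimage [IsFiniteMeasure P] (hθ : IsNoise P ℱ θ)
    (hφ : IsRDS ℱ θ φ) (hc : ∀ᵐ ω ∂P, ω ∈ contractiveSet φ) (x : Circ) (s : k.Time) {A : Set Ω}
    (hA : MeasurableSet[ℱ s] A) :
    P (A ∩ crackFun φ ⁻¹' {x}) = ∫⁻ ω in A, P.map (crackFun φ) {φ s ω x} ∂P := by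
  set S : Set (Ω × Ω) := {p | p.1 ∈ A ∧ φ s p.1 x = crackFun φ p.2}
  have hS : MeasurableSet[(ℱ s : MeasurableSpace Ω).prod (futureSigma ℱ)] S :=
    .inter (@measurable_fst _ _ (ℱ s) (futureSigma ℱ) A hA)
      (hφ.measurable_apply_crackFun s x measurableSet_diagonal)
  have hshift : P (A ∩ crackFun φ ⁻¹' {x}) = P {ω | (ω, θ s ω) ∈ S} := by
    refine measure_congr ?_
    filter_upwards [hc] with ω hω
    refine propext (and_congr_right fun _ => ?_)
    rw [hφ.crackFun_shift s hω, (φ s ω).injective.eq_iff]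
    exact eq_comm
  rw [hshift, hθ.measure_shift s hS, ← lintegral_indicator (ℱ.le s _ hA)]
  refine lintegral_congr fun ω => ?_
  by_cases hω : ω ∈ A
  · simp only [S, Set.mem_ofPred_eq, hω, true_and, Set.indicator_of_mem,
      hφ.map_crackFun_apply (measurableSet_singleton _), Set.mem_singleton_iff, eq_comm]
  · simp only [S, Set.mem_ofPred_eq, hω, false_and, Set.ofPred_false, measure_empty,
      not_false_eq_true, Set.indicator_of_notMem]

/-- The mass of the image of `p` has mean `μ {p}`, where `μ` is the law of the crack point; hence
it is constant if `μ {p}` is maximal. -/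
theorem ae_map_crackFun_singleton_eq [IsProbabilityMeasure P] (hθ : IsNoise P ℱ θ)
    (hφ : IsRDS ℱ θ φ) (hc : ∀ᵐ ω ∂P, ω ∈ contractiveSet φ) {p : Circ}
    (hmax : ∀ y, P.map (crackFun φ) {y} ≤ P.map (crackFun φ) {p}) (s : k.Time) :
    ∀ᵐ ω ∂P, P.map (crackFun φ) {φ s ω p} = P.map (crackFun φ) {p} := by
  have hmean : ∫⁻ ω, P.map (crackFun φ) {φ s ω p} ∂P = P.map (crackFun φ) {p} := by
    have h := hφ.measure_inter_crackFun_preimage hθ hc p s (@MeasurableSet.univ _ (ℱ s))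
    rw [Set.univ_inter, setLIntegral_univ] at h
    rw [← h, hφ.map_crackFun_apply (measurableSet_singleton p)]
    rfl
  refine ae_eq_of_ae_le_of_lintegral_le (.of_forall fun ω => hmax _) ?_ aemeasurable_const ?_
  · rw [hmean]
    exact measure_ne_top _ _
  · rw [hmean, lintegral_const, measure_univ, mul_one]

theorem exists_isDetFixedPoint_map_crackFun_eq_one [IsProbabilityMeasure P]
    (hθ : IsNoise P ℱ θ) (hφ : IsRDS ℱ θ φ) (hc : ∀ᵐ ω ∂P, ω ∈ contractiveSet φ) {x : Circ}
    (hx : P.map (crackFun φ) {x} ≠ 0) :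
    ∃ p, IsDetFixedPoint P φ p ∧ P.map (crackFun φ) {p} = 1 := by
  have : IsProbabilityMeasure (P.map (crackFun φ)) :=
    Measure.isProbabilityMeasure_map hφ.measurable_crackFun.aemeasurable
  obtain ⟨p, hp, hmax⟩ := exists_forall_measure_singleton_le (P.map (crackFun φ)) hx
  have hconst := fun s => hφ.ae_map_crackFun_singleton_eq hθ hc hmax s
  have hpre := hφ.map_crackFun_apply (P := P) (measurableSet_singleton p)
  have hone : P.map (crackFun φ) {p} = 1 := by
    refine (measure_eq_zero_or_one_of_forall_measure_inter_eq_mul (P := P) (ℱ := ℱ)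
      (hφ.measurable_crackFun_future (measurableSet_singleton p)) fun t A hA => ?_).elim
      (fun h => absurd (hpre.trans h) hp) hpre.trans
    rw [hφ.measure_inter_crackFun_preimage hθ hc p t hA,
      lintegral_congr_ae (ae_restrict_of_ae (hconst t)), setLIntegral_const, hpre, mul_comm]
    rfl
  refine ⟨p, hφ.isDetFixedPoint_of_forall_ae fun t => ?_, hone⟩
  filter_upwards [hconst t] with ω hω
  by_contra hne
  have hdisj : Disjoint {φ t ω p} ({p} : Set Circ) := Set.disjoint_singleton.2 hne
  have htwo := measure_union (μ := P.map (crackFun φ)) hdisj (measurableSet_singleton p)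
  rw [hω, hone] at htwo
  exact absurd (htwo ▸ prob_le_one) (by norm_num)

theorem forall_measure_crackEvent_eq_zero_or [IsProbabilityMeasure P] (hθ : IsNoise P ℱ θ)
    (hφ : IsRDS ℱ θ φ) (hc : ∀ᵐ ω ∂P, ω ∈ contractiveSet φ) :
    (∀ x, P (crackEvent φ x) = 0) ∨
      ∃ p, IsDetFixedPoint P φ p ∧ ∀ᵐ ω ∂P, ω ∈ crackEvent φ p := by
  refine or_iff_not_imp_left.2 fun hatom => ?_
  obtain ⟨x, hx⟩ := not_forall.1 hatom
  rw [hφ.measure_crackEvent hc] at hx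
  obtain ⟨p, hp, hone⟩ := hφ.exists_isDetFixedPoint_map_crackFun_eq_one hθ hc hx
  have hae : ∀ᵐ ω ∂P, crackFun φ ω ∈ ({p} : Set Circ) :=
    (mem_ae_iff_prob_eq_one (hφ.measurable_crackFun (measurableSet_singleton p))).2
      ((hφ.map_crackFun_apply (measurableSet_singleton p)).symm.trans hone)
  refine ⟨p, hp, ?_⟩
  filter_upwards [hc, hae] with ω hω hωp
  rw [crackEvent_eq]
  exact ⟨hω, hωp⟩

end IsRDS

end CrackPointLaw

/-! ### Stable synchronisation -/

section StablySynchronising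

variable {k : TimeDomain} {Ω : Type*} [mΩ : MeasurableSpace Ω] {P : Measure Ω}
  {ℱ : Filtration k.Time mΩ} {θ : k.Time → Ω → Ω} {φ : k.Time → Ω → (Circ ≃ₜ Circ)}

theorem ae_crackFun_ne (hc : ∀ᵐ ω ∂P, ω ∈ contractiveSet φ) {x : Circ}
    (hx : P (crackEvent φ x) = 0) : ∀ᵐ ω ∂P, crackFun φ ω ≠ x := by
  filter_upwards [hc, measure_eq_zero_iff_ae_notMem.1 hx] with ω hω hnot heq
  exact hnot (by rw [crackEvent_eq]; exact ⟨hω, heq⟩)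

theorem stablySynchronising_of_measure_crackEvent_eq_zero
    (hc : ∀ᵐ ω ∂P, ω ∈ contractiveSet φ) (ha : ∀ x, P (crackEvent φ x) = 0) :
    StablySynchronising P φ := by
  refine ⟨fun x y => ?_, fun x => ?_⟩
  · filter_upwards [hc, ae_crackFun_ne hc (ha x), ae_crackFun_ne hc (ha y)] with ω hω hx hy
    exact (isCrackPoint_crackFun hω).synced hx.symm hy.symm
  · filter_upwards [hc, ae_crackFun_ne hc (ha x)] with ω hω hx
    obtain ⟨U, V, hU, hV, hrU, hxV, hUV⟩ := t2_separation hx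
    exact ⟨V, hV, hxV, ((isCrackPoint_crackFun hω).isContracted_compl hU hrU).mono
      hUV.subset_compl_left⟩

theorem EverywhereLocallyStable.exists_ball [IsFiniteMeasure P] (hφ : IsRDS ℱ θ φ)
    (h : EverywhereLocallyStable P φ) (x : Circ) {c : ℝ≥0∞} (hc : 0 < c) :
    ∃ r > 0, P {ω | ¬ IsContracted φ ω (Metric.ball x r)} < c := by
  set S : ℕ → Set Ω := fun n => {ω | ¬ IsContracted φ ω (Metric.ball x (1 / (n + 1)))}
  have hS : ∀ n, MeasurableSet (S n) := fun n =>
    futureSigma_le ℱ _ (hφ.measurableSet_isContracted Metric.isOpen_ball).compl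
  have hanti : Antitone S := fun _ _ hmn _ hω hm =>
    hω (hm.mono (Metric.ball_subset_ball (Nat.one_div_le_one_div hmn)))
  have hnull : P (⋂ n, S n) = 0 := by
    rw [measure_eq_zero_iff_ae_notMem]
    filter_upwards [h x] with ω ⟨U, hU, hxU, hcU⟩ hω
    obtain ⟨δ, hδ, hball⟩ := Metric.isOpen_iff.1 hU x hxU
    obtain ⟨n, hn⟩ := exists_nat_one_div_lt hδ
    exact Set.mem_iInter.1 hω n
      (IsContracted.mono hcU ((Metric.ball_subset_ball hn.le).trans hball))
  have hlim := tendsto_measure_iInter_atTop (μ := P) (fun n => (hS n).nullMeasurableSet) hanti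
    ⟨0, measure_ne_top _ _⟩
  rw [hnull] at hlim
  obtain ⟨n, hn⟩ := (hlim.eventually_lt_const hc).exists
  exact ⟨_, Nat.one_div_pos_of_nat, hn⟩

theorem EverywhereLocallyStable.exists_forall_ball [IsFiniteMeasure P] (hφ : IsRDS ℱ θ φ)
    (h : EverywhereLocallyStable P φ) {c : ℝ≥0∞} (hc : 0 < c) :
    ∃ δ > 0, ∀ x, P {ω | ¬ IsContracted φ ω (Metric.ball x δ)} < c := by
  choose r hr hlt using fun x => h.exists_ball hφ x hc
  obtain ⟨δ, hδ, hsub⟩ := lebesgue_number_lemma_of_metric (isCompact_univ (X := Circ))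
    (fun x => Metric.isOpen_ball (x := x) (ε := r x))
    fun x _ => Set.mem_iUnion.2 ⟨x, Metric.mem_ball_self (hr x)⟩
  refine ⟨δ, hδ, fun x => ?_⟩
  obtain ⟨y, hy⟩ := hsub x trivial
  refine lt_of_le_of_lt (measure_mono fun ω hω => ?_) (hlt y)
  exact fun hball => hω (hball.mono hy)

theorem IsRDS.isContracted_or_compl (hφ : IsRDS ℱ θ φ) {s : k.Time} {ω : Ω} {B : Set Circ}
    {x : Circ} {r : ℝ} (hB : φ s ω '' frontier B ⊆ Metric.ball x r)
    (hc : IsContracted φ (θ s ω) (Metric.ball x r)) :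
    IsContracted φ ω B ∨ IsContracted φ ω Bᶜ := by
  rw [(φ s ω).image_frontier] at hB
  refine (Circ.subset_ball_or_compl_subset_ball hB).imp (fun hsub => ?_) fun hsub => ?_
  · exact (hφ.isContracted_shift_iff s ω B).1 (hc.mono hsub)
  · rw [← Set.image_compl_eq (φ s ω).bijective] at hsub
    exact (hφ.isContracted_shift_iff s ω Bᶜ).1 (hc.mono hsub)

open TopologicalSpace in
/-- Once the images of `a` and `b` lie in a common small ball, that ball is contracted with high
probability, and it contains the image of `B` or of its complement. -/
theorem StablySynchronising.ae_isContracted_or_compl [IsProbabilityMeasure P]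
    (hθ : IsNoise P ℱ θ) (hφ : IsRDS ℱ θ φ) (h : StablySynchronising P φ) {B : Set Circ}
    {a b : Circ} (hB : frontier B ⊆ {a, b}) :
    ∀ᵐ ω ∂P, IsContracted φ ω B ∨ IsContracted φ ω Bᶜ := by
  refine le_antisymm (le_of_forall_gt fun c hc => ?_) zero_le
  obtain ⟨c', hc'0, hc'⟩ := exists_between hc
  obtain ⟨δ, hδ, hball⟩ := h.2.exists_forall_ball hφ hc'0
  set s : ℕ → k.Time := k.natTime
  set S : ℕ → Set (Ω × Ω) := fun n =>
    {p | ∀ j, φ (s n) p.1 a ∈ Metric.ball (denseSeq Circ j) (δ / 2) →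
      ¬ IsContracted φ p.2 (Metric.ball (denseSeq Circ j) δ)}
  have hS : ∀ n, MeasurableSet[(ℱ (s n) : MeasurableSpace Ω).prod (futureSigma ℱ)] (S n) := by
    intro n
    simp only [S, Set.ofPred_forall]
    refine MeasurableSet.iInter fun j => .imp ?_ ?_
    · exact (hφ.measurable_apply_past (s n) a).comp (@measurable_fst _ _ (ℱ (s n)) (futureSigma ℱ))
        Metric.isOpen_ball.measurableSet
    · exact @measurable_snd _ _ (ℱ (s n)) (futureSigma ℱ) _
        (hφ.measurableSet_isContracted Metric.isOpen_ball).compl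
  have hle : ∀ n ω, P {ω' | (ω, ω') ∈ S n} ≤ c' := by
    intro n ω
    obtain ⟨j, hj⟩ := (denseRange_denseSeq Circ).exists_dist_lt (φ (s n) ω a) (half_pos hδ)
    exact le_trans (measure_mono fun ω' hω' => hω' j hj) (hball (denseSeq Circ j)).le
  refine lt_of_le_of_lt ?_ hc'
  refine le_trans (measure_mono_ae ?_) (hθ.measure_setOf_eventually_shift_mem_le hS hle)
  filter_upwards [h.1 a b] with ω hsync hnot
  filter_upwards [(hsync.comp k.tendsto_natTime).eventually_lt_const (half_pos hδ)]
    with n hn j haj hcontr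
  refine hnot (hφ.isContracted_or_compl ((Set.image_mono hB).trans ?_) hcontr)
  rw [Set.image_pair, Set.pair_subset_iff]
  refine ⟨Metric.ball_subset_ball (half_le_self hδ.le) haj, ?_⟩
  calc dist (φ (s n) ω b) (denseSeq Circ j)
      ≤ dist (φ (s n) ω a) (φ (s n) ω b) + dist (φ (s n) ω a) (denseSeq Circ j) :=
        dist_triangle_left _ _ _
    _ < δ / 2 + δ / 2 := add_lt_add hn haj
    _ = δ := add_halves δ

/-- Among finitely many small balls covering the circle, some ball is not contracted, so its
complement is. -/
theorem StablySynchronising.ae_mem_contractiveSet [IsProbabilityMeasure P] (hθ : IsNoise P ℱ θ)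
    (hφ : IsRDS ℱ θ φ) (h : StablySynchronising P φ) : ∀ᵐ ω ∂P, ω ∈ contractiveSet φ := by
  have hall : ∀ᵐ ω ∂P, ∀ n j, IsContracted φ ω (denseBall j n) ∨
      IsContracted φ ω (denseBall j n)ᶜ :=
    ae_all_iff.2 fun n => ae_all_iff.2 fun j => h.ae_isContracted_or_compl hθ hφ
      (Metric.frontier_closedBall_subset_sphere.trans (Circ.sphere_subset _ _))
  filter_upwards [hall] with ω hω
  refine mem_contractiveSet_iff.2 fun n => ?_
  obtain ⟨t, ht⟩ := isCompact_univ.elim_finite_subcover (fun j => interior (denseBall j n))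
    (fun j => isOpen_interior) fun x _ => Set.mem_iUnion.2 (exists_mem_interior_denseBall x n)
  by_contra! hno
  refine not_isContracted_univ (φ := φ) (ω := ω) ?_
  exact (IsContracted.biUnion fun j (_ : j ∈ t) => (hω n j).resolve_right (hno j)).mono
    (ht.trans (Set.iUnion₂_mono fun j _ => interior_subset))

theorem StablySynchronising.measure_crackEvent_eq_zero [IsProbabilityMeasure P]
    (hθ : IsNoise P ℱ θ) (hφ : IsRDS ℱ θ φ) (h : StablySynchronising P φ) (x : Circ) :
    P (crackEvent φ x) = 0 := by
  refine (hφ.forall_measure_crackEvent_eq_zero_or hθ (h.ae_mem_contractiveSet hθ hφ)).resolve_right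
    ?_ x
  rintro ⟨p, -, hp⟩
  obtain ⟨ω, ⟨hω, rfl⟩, U, hU, hpU, hcU⟩ := (hp.and (h.2 p)).exists
  have hcrack : IsCrackPoint φ ω (crackPoint φ ⟨ω, hω⟩) := hω.choose_spec
  exact IsContracted.not_compl hcU (hcrack.isContracted_compl hU hpU)

theorem stablySynchronising_iff [IsProbabilityMeasure P] (hθ : IsNoise P ℱ θ)
    (hφ : IsRDS ℱ θ φ) :
    StablySynchronising P φ ↔
      (∀ᵐ ω ∂P, ω ∈ contractiveSet φ) ∧ ∀ x, P (crackEvent φ x) = 0 :=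
  ⟨fun h => ⟨h.ae_mem_contractiveSet hθ hφ, h.measure_crackEvent_eq_zero hθ hφ⟩,
    fun h => stablySynchronising_of_measure_crackEvent_eq_zero h.1 h.2⟩

end StablySynchronising

section Repulsive

variable {k : TimeDomain} {Ω : Type*} [mΩ : MeasurableSpace Ω] {P : Measure Ω}
  {ℱ : Filtration k.Time mΩ} {θ : k.Time → Ω → Ω} {φ : k.Time → Ω → (Circ ≃ₜ Circ)}

/-- Given the past, the crack point at time `n` is distributed like the original one, hence is
unlikely to be close to the image of `y`. -/
theorem IsRDS.ae_not_synced_crackFun [IsProbabilityMeasure P] (hθ : IsNoise P ℱ θ)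
    (hφ : IsRDS ℱ θ φ) (hc : ∀ᵐ ω ∂P, ω ∈ contractiveSet φ) (ha : ∀ x, P (crackEvent φ x) = 0)
    (y : Circ) : ∀ᵐ ω ∂P, ¬ Synced φ ω y (crackFun φ ω) := by
  refine le_antisymm (le_of_forall_gt fun c hc0 => ?_) zero_le
  obtain ⟨c', hc'0, hc'⟩ := exists_between hc0
  obtain ⟨δ, hδ, hball⟩ := exists_forall_measure_ball_lt (μ := P.map (crackFun φ))
    (c := c') fun x => by rwa [← hφ.measure_crackEvent hc, ha x]
  set s : ℕ → k.Time := k.natTime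
  set S : ℕ → Set (Ω × Ω) := fun n => {p | dist (φ (s n) p.1 y) (crackFun φ p.2) < δ}
  have hS : ∀ n, MeasurableSet[(ℱ (s n) : MeasurableSpace Ω).prod (futureSigma ℱ)] (S n) :=
    fun n => hφ.measurable_apply_crackFun (s n) y
      (measurableSet_lt (measurable_fst.dist measurable_snd) measurable_const)
  have hle : ∀ n ω, P {ω' | (ω, ω') ∈ S n} ≤ c' := by
    intro n ω
    refine le_trans (le_of_eq ?_) (hball (φ (s n) ω y)).le
    rw [hφ.map_crackFun_apply Metric.isOpen_ball.measurableSet]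
    simp only [S, Set.mem_ofPred_eq, Metric.mem_ball']
  refine lt_of_le_of_lt ?_ hc'
  refine le_trans (measure_mono_ae ?_) (hθ.measure_setOf_eventually_shift_mem_le hS hle)
  filter_upwards [hc] with ω hω hsync
  filter_upwards [((not_not.1 hsync).comp k.tendsto_natTime).eventually_lt_const hδ] with n hn
  change dist _ _ < δ
  rw [hφ.crackFun_shift _ hω]
  exact hn

theorem IsRDS.ae_isRepulsiveCrackPoint [IsProbabilityMeasure P] (hθ : IsNoise P ℱ θ)
    (hφ : IsRDS ℱ θ φ) (hc : ∀ᵐ ω ∂P, ω ∈ contractiveSet φ)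
    (ha : ∀ x, P (crackEvent φ x) = 0) :
    ∀ᵐ ω ∂P, ∀ h : ω ∈ contractiveSet φ,
      IsRepulsiveCrackPoint φ ω (crackPoint φ ⟨ω, h⟩) := by
  filter_upwards [hφ.ae_not_synced_crackFun hθ hc ha 0, ae_crackFun_ne hc (ha 0)]
    with ω hnot hne hω
  rw [← crackFun_of_mem hω]
  exact (isCrackPoint_crackFun hω).isRepulsiveCrackPoint hne.symm hnot

end Repulsive

theorem tendsto_sub_of_tendsto_dist {X ι : Type*} [PseudoMetricSpace X] {f : X → ℝ}
    (hf : UniformContinuous f) {l : Filter ι} {u v : ι → X}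
    (h : Tendsto (fun i => dist (u i) (v i)) l (𝓝 0)) :
    Tendsto (fun i => f (u i) - f (v i)) l (𝓝 0) :=
  tendsto_zero_iff_norm_tendsto_zero.2 <| tendsto_uniformity_iff_dist_tendsto_zero.1 <|
    Tendsto.comp hf <| tendsto_uniformity_iff_dist_tendsto_zero (f := fun i => (u i, v i)).2 h

theorem measure_eq_of_forall_integral_continuousMap_eq {X : Type*} [TopologicalSpace X]
    [MeasurableSpace X] [BorelSpace X] [HasOuterApproxClosed X] {μ ν : Measure X}
    [IsFiniteMeasure μ] [IsFiniteMeasure ν] (h : ∀ f : C(X, ℝ), ∫ x, f x ∂μ = ∫ x, f x ∂ν) :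
    μ = ν :=
  ext_of_forall_integral_eq_of_IsFiniteMeasure fun f => h f.toContinuousMap

section CompactSpace

variable {X : Type*} [TopologicalSpace X] [CompactSpace X] [MeasurableSpace X]

theorem integrable_continuousMap [OpensMeasurableSpace X] (μ : Measure X) [IsFiniteMeasure μ]
    (f : C(X, ℝ)) : Integrable f μ :=
  (BoundedContinuousFunction.mkOfCompact f).integrable μ

theorem tendsto_probabilityMeasure_iff_forall_integral_tendsto [OpensMeasurableSpace X]
    {ι : Type*} {l : Filter ι} {μ : ι → ProbabilityMeasure X} {ν : ProbabilityMeasure X} :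
    Tendsto μ l (𝓝 ν) ↔
      ∀ f : C(X, ℝ), Tendsto (fun i => ∫ x, f x ∂(μ i : Measure X)) l (𝓝 (∫ x, f x ∂ν)) :=
  ProbabilityMeasure.tendsto_iff_forall_integral_tendsto.trans
    ⟨fun h f => h (.mkOfCompact f), fun h f => h f.toContinuousMap⟩

end CompactSpace

/-! ### The transition semigroup -/

section Transition

variable {k : TimeDomain} {Ω : Type*} [mΩ : MeasurableSpace Ω] {P : Measure Ω}
  {ℱ : Filtration k.Time mΩ} {θ : k.Time → Ω → Ω} {φ : k.Time → Ω → (Circ ≃ₜ Circ)}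

namespace IsRDS

theorem measurable_comp_apply (hφ : IsRDS ℱ θ φ) (f : C(Circ, ℝ)) (t : k.Time) (x : Circ) :
    Measurable fun ω => f (φ t ω x) :=
  f.continuous.measurable.comp (hφ.measurable_apply t x)

theorem integrable_comp_apply [IsFiniteMeasure P] (hφ : IsRDS ℱ θ φ) (f : C(Circ, ℝ)) (t : k.Time)
    (x : Circ) : Integrable (fun ω => f (φ t ω x)) P :=
  .of_bound (hφ.measurable_comp_apply f t x).aestronglyMeasurable ‖f‖
    (.of_forall fun _ => f.norm_coe_le_norm _)

/-- The operator of the transition semigroup at time `t`, `(P_t f) x = 𝔼 (f (φ t · x))`, acting on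
continuous functions. -/
noncomputable def transitionOp (hφ : IsRDS ℱ θ φ) (P : Measure Ω) [IsFiniteMeasure P]
    (t : k.Time) (f : C(Circ, ℝ)) : C(Circ, ℝ) where
  toFun x := ∫ ω, f (φ t ω x) ∂P
  continuous_toFun := continuous_of_dominated (fun x => (hφ.integrable_comp_apply f t x).1)
    (fun _ => .of_forall fun _ => f.norm_coe_le_norm _) (integrable_const _)
    (.of_forall fun ω => f.continuous.comp (φ t ω).continuous)

theorem transitionOp_apply [IsFiniteMeasure P] (hφ : IsRDS ℱ θ φ) (t : k.Time) (f : C(Circ, ℝ))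
    (x : Circ) : hφ.transitionOp P t f x = ∫ ω, f (φ t ω x) ∂P := rfl

theorem norm_transitionOp_le [IsProbabilityMeasure P] (hφ : IsRDS ℱ θ φ) (t : k.Time)
    (f : C(Circ, ℝ)) : ‖hφ.transitionOp P t f‖ ≤ ‖f‖ := by
  refine (ContinuousMap.norm_le _ (norm_nonneg f)).2 fun x => ?_
  simpa [transitionOp_apply] using norm_integral_le_of_norm_le_const (μ := P)
    (.of_forall fun ω => f.norm_coe_le_norm (φ t ω x))

theorem integral_mul_apply_add [IsFiniteMeasure P] (hθ : IsNoise P ℱ θ) (hφ : IsRDS ℱ θ φ)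
    (s t : k.Time) (f : C(Circ, ℝ)) (x : Circ) {W : Ω → ℝ} (hW : Measurable[ℱ s] W)
    (hWint : Integrable W P) :
    ∫ ω, W ω * f (φ (s + t) ω x) ∂P = ∫ ω, W ω * hφ.transitionOp P t f (φ s ω x) ∂P := by
  have hG : Measurable[(ℱ s : MeasurableSpace Ω).prod (futureSigma ℱ)]
      fun p : Ω × Ω => W p.1 * f (φ t p.2 (φ s p.1 x)) := by
    have hfst := @measurable_fst _ _ (ℱ s) (futureSigma ℱ)
    have hsnd := @measurable_snd _ _ (ℱ s) (futureSigma ℱ)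
    refine (hW.comp hfst).mul (f.continuous.measurable.comp ?_)
    exact (hφ.measurable_future t).comp
      (hsnd.prodMk ((hφ.measurable_apply_past s x).comp hfst))
  have hint : Integrable (fun ω => W ω * f (φ t (θ s ω) (φ s ω x))) P := by
    simp only [← hφ.cocycle]
    exact hWint.mul_bdd (hφ.measurable_comp_apply f (s + t) x).aestronglyMeasurable
      (.of_forall fun _ => f.norm_coe_le_norm _)
  simp only [hφ.cocycle s t, transitionOp_apply, ← integral_const_mul]
  exact hθ.integral_shift s hG hint

theorem transitionOp_add [IsProbabilityMeasure P] (hθ : IsNoise P ℱ θ) (hφ : IsRDS ℱ θ φ)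
    (s t : k.Time) (f : C(Circ, ℝ)) :
    hφ.transitionOp P (s + t) f = hφ.transitionOp P s (hφ.transitionOp P t f) := by
  ext x
  simpa only [one_mul, transitionOp_apply] using
    hφ.integral_mul_apply_add hθ s t f x (W := fun _ => 1) measurable_const (integrable_const 1)

theorem tendsto_transitionOp_sub [IsFiniteMeasure P] (hφ : IsRDS ℱ θ φ) (f : C(Circ, ℝ))
    {ι : Type*} {l : Filter ι} [l.IsCountablyGenerated] {u : ι → k.Time} {x y : ι → Circ}
    (h : ∀ᵐ ω ∂P, Tendsto (fun i => dist (φ (u i) ω (x i)) (φ (u i) ω (y i))) l (𝓝 0)) :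
    Tendsto (fun i => hφ.transitionOp P (u i) f (x i) - hφ.transitionOp P (u i) f (y i)) l
      (𝓝 0) := by
  have hint := fun i z => hφ.integrable_comp_apply (P := P) f (u i) z
  simp only [transitionOp_apply, ← integral_sub (hint _ _) (hint _ _)]
  rw [← integral_zero Ω ℝ (μ := P)]
  refine tendsto_integral_filter_of_dominated_convergence (fun _ => ‖f‖ + ‖f‖)
    (.of_forall fun i => ((hint i _).sub (hint i _)).1)
    (.of_forall fun i => .of_forall fun ω =>
      norm_sub_le_of_le (f.norm_coe_le_norm _) (f.norm_coe_le_norm _)) (integrable_const _) ?_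
  filter_upwards [h] with ω hω
  exact tendsto_sub_of_tendsto_dist
    (CompactSpace.uniformContinuous_of_continuous f.continuous) hω

end IsRDS

/-! ### Stationary measures -/

theorem isStationaryMeasure_iff_map [SFinite P] (hφ : IsRDS ℱ θ φ) {ρ : Measure Circ} :
    IsStationaryMeasure P φ ρ ↔
      IsProbabilityMeasure ρ ∧ ∀ t, (P.prod ρ).map (fun p => φ t p.1 p.2) = ρ := by
  refine and_congr_right fun _ => forall_congr' fun t => ?_
  simp only [Measure.ext_iff]
  refine forall₂_congr fun A hA => ?_
  rw [Measure.map_apply (hφ.measurable_uncurry t) hA,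
    Measure.prod_apply_symm (hφ.measurable_uncurry t hA)]
  exact eq_comm

theorem isStationaryMeasure_iff_integral [IsProbabilityMeasure P] (hφ : IsRDS ℱ θ φ)
    {ρ : Measure Circ} :
    IsStationaryMeasure P φ ρ ↔
      IsProbabilityMeasure ρ ∧ ∀ t f, ∫ x, hφ.transitionOp P t f x ∂ρ = ∫ x, f x ∂ρ := by
  refine (isStationaryMeasure_iff_map hφ).trans
    (and_congr_right fun _ => forall_congr' fun t => ?_)
  have hmap : ∀ f : C(Circ, ℝ), ∫ x, f x ∂(P.prod ρ).map (fun p => φ t p.1 p.2) =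
      ∫ x, hφ.transitionOp P t f x ∂ρ := fun f => by
    have hm := (hφ.measurable_uncurry t).aemeasurable (μ := P.prod ρ)
    rw [integral_map hm f.continuous.aestronglyMeasurable, integral_prod_symm]
    · rfl
    · exact (integrable_continuousMap _ f).comp_aemeasurable hm
  have := Measure.isProbabilityMeasure_map (hφ.measurable_uncurry t).aemeasurable (μ := P.prod ρ)
  simp only [← hmap]
  exact ⟨fun h f => by rw [h], measure_eq_of_forall_integral_continuousMap_eq⟩

theorem isStationaryMeasure_dirac [IsProbabilityMeasure P] (hφ : IsRDS ℱ θ φ) {p : Circ}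
    (hp : IsDetFixedPoint P φ p) : IsStationaryMeasure P φ (Measure.dirac p) := by
  refine (isStationaryMeasure_iff_integral hφ).2 ⟨inferInstance, fun t f => ?_⟩
  rw [integral_dirac, integral_dirac, hφ.transitionOp_apply,
    integral_congr_ae (hp.mono fun ω hω => congrArg f (hω t)), integral_const, probReal_univ,
    one_smul]

theorem Synchronising.tendsto_integral_transitionOp_sub [IsProbabilityMeasure P]
    (hφ : IsRDS ℱ θ φ) (h : Synchronising P φ) (μ : Measure Circ) [IsProbabilityMeasure μ]
    (f : C(Circ, ℝ)) (x : Circ) :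
    Tendsto (fun n => ∫ y, hφ.transitionOp P (k.natTime n) f y ∂μ -
      hφ.transitionOp P (k.natTime n) f x) atTop (𝓝 0) := by
  have hsub : ∀ g : C(Circ, ℝ), ∫ y, g y ∂μ - g x = ∫ y, (g y - g x) ∂μ := fun g => by
    rw [integral_sub (integrable_continuousMap μ g) (integrable_const _), integral_const,
      probReal_univ, one_smul]
  simp only [hsub]
  rw [← integral_zero Circ ℝ (μ := μ)]
  refine tendsto_integral_of_dominated_convergence (fun _ => ‖f‖ + ‖f‖)
    (fun n => ((integrable_continuousMap μ _).sub (integrable_const _)).1) (integrable_const _)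
    (fun n => .of_forall fun y => ?_) (.of_forall fun y => ?_)
  · exact norm_sub_le_of_le
      ((ContinuousMap.norm_coe_le_norm _ _).trans (hφ.norm_transitionOp_le _ f))
      ((ContinuousMap.norm_coe_le_norm _ _).trans (hφ.norm_transitionOp_le _ f))
  · exact hφ.tendsto_transitionOp_sub f ((h y x).mono fun ω hω => hω.comp k.tendsto_natTime)

/-- Any weak limit point of the laws of `φ n · 0` is stationary. -/
theorem Synchronising.exists_isStationaryMeasure [IsProbabilityMeasure P] (hθ : IsNoise P ℱ θ)
    (hφ : IsRDS ℱ θ φ) (h : Synchronising P φ) : ∃ ρ, IsStationaryMeasure P φ ρ := by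
  have hlaw : ∀ t, IsProbabilityMeasure (P.map fun ω => φ t ω 0) := fun t =>
    Measure.isProbabilityMeasure_map (hφ.measurable_apply t 0).aemeasurable
  have hint : ∀ t (f : C(Circ, ℝ)), ∫ x, f x ∂P.map (fun ω => φ t ω 0) =
      hφ.transitionOp P t f 0 := fun t f =>
    integral_map (hφ.measurable_apply t 0).aemeasurable f.continuous.aestronglyMeasurable
  let μ : ℕ → ProbabilityMeasure Circ := fun n => ⟨P.map fun ω => φ (k.natTime n) ω 0, hlaw _⟩
  obtain ⟨ρ, σ, hσ, hρ⟩ := CompactSpace.tendsto_subseq μ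
  have hlim : ∀ f : C(Circ, ℝ), Tendsto (fun n => hφ.transitionOp P (k.natTime (σ n)) f 0) atTop
      (𝓝 (∫ x, f x ∂ρ)) := fun f =>
    (tendsto_probabilityMeasure_iff_forall_integral_tendsto.1 hρ f).congr fun n => hint _ f
  refine ⟨ρ, (isStationaryMeasure_iff_integral hφ).2 ⟨inferInstance, fun t f => ?_⟩⟩
  have hcomm : ∀ n, hφ.transitionOp P (k.natTime n) (hφ.transitionOp P t f) 0 =
      ∫ x, hφ.transitionOp P (k.natTime n) f x ∂P.map (fun ω => φ t ω 0) := fun n => by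
    rw [hint, ← hφ.transitionOp_add hθ, ← hφ.transitionOp_add hθ, add_comm]
  have hdiff := (hlim (hφ.transitionOp P t f)).sub (hlim f)
  simp only [hcomm] at hdiff
  exact sub_eq_zero.1 (tendsto_nhds_unique hdiff
    ((h.tendsto_integral_transitionOp_sub hφ _ f 0).comp hσ.tendsto_atTop))

theorem Synchronising.tendsto_transitionOp_apply [IsProbabilityMeasure P] (hφ : IsRDS ℱ θ φ)
    (h : Synchronising P φ) {ρ : Measure Circ} (hρ : IsStationaryMeasure P φ ρ) (f : C(Circ, ℝ))
    (x : Circ) :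
    Tendsto (fun n => hφ.transitionOp P (k.natTime n) f x) atTop (𝓝 (∫ y, f y ∂ρ)) := by
  have := hρ.1
  have hdiff := h.tendsto_integral_transitionOp_sub hφ ρ f x
  simp only [((isStationaryMeasure_iff_integral hφ).1 hρ).2] at hdiff
  simpa only [sub_sub_cancel, sub_zero] using hdiff.const_sub (∫ y, f y ∂ρ)

theorem Synchronising.stationaryMeasure_unique [IsProbabilityMeasure P] (hφ : IsRDS ℱ θ φ)
    (h : Synchronising P φ) {ρ ρ' : Measure Circ} (hρ : IsStationaryMeasure P φ ρ)
    (hρ' : IsStationaryMeasure P φ ρ') : ρ = ρ' := by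
  have := hρ.1
  have := hρ'.1
  exact measure_eq_of_forall_integral_continuousMap_eq fun f => tendsto_nhds_unique
    (h.tendsto_transitionOp_apply hφ hρ f 0) (h.tendsto_transitionOp_apply hφ hρ' f 0)

theorem StablySynchronising.tendsto_transitionOp [IsProbabilityMeasure P] (hφ : IsRDS ℱ θ φ)
    (h : StablySynchronising P φ) {ρ : Measure Circ} (hρ : IsStationaryMeasure P φ ρ)
    (f : C(Circ, ℝ)) :
    Tendsto (fun n => hφ.transitionOp P (k.natTime n) f) atTop
      (𝓝 (ContinuousMap.const Circ (∫ y, f y ∂ρ))) := by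
  refine ContinuousMap.tendsto_iff_tendstoLocallyUniformly.2
    (tendstoLocallyUniformly_iff_forall_tendsto.2 fun x => ?_)
  have hdist : Tendsto (fun p : ℕ × Circ =>
      hφ.transitionOp P (k.natTime p.1) f p.2 - hφ.transitionOp P (k.natTime p.1) f x)
      (atTop ×ˢ 𝓝 x) (𝓝 0) := by
    refine hφ.tendsto_transitionOp_sub f ?_
    filter_upwards [h.2 x] with ω ⟨U, hU, hxU, hcU⟩
    obtain ⟨V, hVU, hV, hxV, hVc⟩ := locallyConnectedSpace_iff_subsets_isOpen_isConnected.1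
      inferInstance x U (hU.mem_nhds hxU)
    have hcV := (ENNReal.tendsto_toReal ENNReal.zero_ne_top).comp
      (((IsContracted.mono hcU hVU).comp k.tendsto_natTime).comp
        (tendsto_fst (f := atTop) (g := 𝓝 x)))
    refine squeeze_zero' (.of_forall fun _ => dist_nonneg) ?_ hcV
    filter_upwards [tendsto_snd.eventually_mem (hV.mem_nhds hxV)] with p hp
    refine (ENNReal.ofReal_le_iff_le_toReal (measure_ne_top _ _)).1 (Circ.dist_le_volume
      (hVc.isPreconnected.image _ (φ (k.natTime p.1) ω).continuous.continuousOn) ?_ ?_)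
    exacts [Set.mem_image_of_mem _ hp, Set.mem_image_of_mem _ hxV]
  have hlim := hdist.add ((h.1.tendsto_transitionOp_apply hφ hρ f x).comp tendsto_fst)
  simp only [Function.comp_apply, sub_add_cancel, zero_add] at hlim
  rw [tendsto_uniformity_iff_dist_tendsto_zero]
  simpa only [dist_comm, ContinuousMap.const_apply] using tendsto_iff_dist_tendsto_zero.1 hlim

end Transition

/-! ### Atoms of stationary measures -/

section Atoms

variable {k : TimeDomain} {Ω : Type*} [mΩ : MeasurableSpace Ω] {P : Measure Ω}
  {ℱ : Filtration k.Time mΩ} {θ : k.Time → Ω → Ω} {φ : k.Time → Ω → (Circ ≃ₜ Circ)}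

theorem IsStationaryMeasure.measure_singleton [SFinite P] (hφ : IsRDS ℱ θ φ) {ρ : Measure Circ}
    (hρ : IsStationaryMeasure P φ ρ) (t : k.Time) (y : Circ) :
    ρ {y} = ∫⁻ ω, ρ {(φ t ω).symm y} ∂P := by
  have := hρ.1
  have hpre : ∀ ω, φ t ω ⁻¹' {y} = {(φ t ω).symm y} := fun ω =>
    Set.ext fun x => (φ t ω).toEquiv.eq_symm_apply.symm
  conv_lhs => rw [← ((isStationaryMeasure_iff_map hφ).1 hρ).2 t]
  rw [Measure.map_apply (hφ.measurable_uncurry t) (measurableSet_singleton y),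
    Measure.prod_apply (hφ.measurable_uncurry t (measurableSet_singleton y))]
  exact lintegral_congr fun ω => congrArg ρ (hpre ω)

theorem IsStationaryMeasure.ae_measure_symm_apply_eq [IsProbabilityMeasure P] (hφ : IsRDS ℱ θ φ)
    {ρ : Measure Circ} (hρ : IsStationaryMeasure P φ ρ) {y : Circ} (hy : ∀ x, ρ {x} ≤ ρ {y})
    (t : k.Time) : ∀ᵐ ω ∂P, ρ {(φ t ω).symm y} = ρ {y} := by
  have := hρ.1
  refine ae_eq_of_ae_le_of_lintegral_le (.of_forall fun ω => hy _) ?_ aemeasurable_const ?_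
  · rw [← hρ.measure_singleton hφ]
    exact measure_ne_top _ _
  · rw [← hρ.measure_singleton hφ, lintegral_const, measure_univ, mul_one]

theorem IsStationaryMeasure.ae_mapsTo_atoms [IsProbabilityMeasure P] (hφ : IsRDS ℱ θ φ)
    {ρ : Measure Circ} (hρ : IsStationaryMeasure P φ ρ) {p : Circ} (hp : ρ {p} ≠ 0)
    (hmax : ∀ x, ρ {x} ≤ ρ {p}) (t : k.Time) :
    ∀ᵐ ω ∂P, Set.MapsTo (φ t ω) {x | ρ {p} ≤ ρ {x}} {x | ρ {p} ≤ ρ {x}} := by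
  have := hρ.1
  set K : Set Circ := {x | ρ {p} ≤ ρ {x}}
  have hK : K.Finite := finite_setOf_le_measure_singleton ρ hp
  have hback : ∀ᵐ ω ∂P, ∀ y ∈ K, (φ t ω).symm y ∈ K :=
    (ae_ball_iff hK.countable).2 fun y hy => (hρ.ae_measure_symm_apply_eq hφ
      (fun x => (hmax x).trans hy) t).mono fun ω hω => hy.trans hω.ge
  filter_upwards [hback] with ω hω x hx
  have hsurj : (φ t ω).symm '' K = K := Set.eq_of_subset_of_ncard_le (Set.image_subset_iff.2 hω)
    (Set.ncard_image_of_injective K (φ t ω).symm.injective).ge hK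
  obtain ⟨y, hy, rfl⟩ := hsurj.symm ▸ hx
  rwa [(φ t ω).apply_symm_apply]

theorem Synchronising.subsingleton_of_ae_mapsTo [NeZero P] (h : Synchronising P φ) {K : Set Circ}
    (hK : K.Finite) (hmaps : ∀ t, ∀ᵐ ω ∂P, Set.MapsTo (φ t ω) K K) : K.Subsingleton := by
  by_contra hne
  obtain ⟨x, hx, y, hy, hxy⟩ := Set.not_subsingleton_iff.1 hne
  obtain ⟨ω, hω, hsync⟩ := ((ae_all_iff.2 fun n => hmaps (k.natTime n)).and (h x y)).exists
  obtain ⟨n, hn⟩ := ((hsync.comp k.tendsto_natTime).eventually_lt_const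
    (hK.infsep_pos_iff_nontrivial.2 (Set.not_subsingleton_iff.1 hne))).exists
  exact hn.not_ge (Set.infsep_le_dist_of_mem (hω n hx) (hω n hy) ((φ _ ω).injective.ne hxy))

/-- The atoms of maximal mass form a finite invariant set, which synchronisation reduces to a
deterministic fixed point `p`; then `δ_p` is the stationary measure. -/
theorem Synchronising.measure_singleton_eq_zero [IsProbabilityMeasure P] (hφ : IsRDS ℱ θ φ)
    (h : Synchronising P φ) {ρ : Measure Circ} (hρ : IsStationaryMeasure P φ ρ) {q : Circ}
    (hq : ¬ IsDetFixedPoint P φ q) : ρ {q} = 0 := by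
  have := hρ.1
  by_contra hne
  obtain ⟨p, hp, hmax⟩ := exists_forall_measure_singleton_le ρ hne
  have hmaps := hρ.ae_mapsTo_atoms hφ hp hmax
  have hK := h.subsingleton_of_ae_mapsTo (finite_setOf_le_measure_singleton ρ hp) hmaps
  have hpK : p ∈ {x | ρ {p} ≤ ρ {x}} := le_refl (ρ {p})
  have hfix : IsDetFixedPoint P φ p := hφ.isDetFixedPoint_of_forall_ae fun t =>
    (hmaps t).mono fun ω hω => hK (hω hpK) hpK
  have hqp : q ≠ p := fun hqp => hq (hqp ▸ hfix)
  rw [h.stationaryMeasure_unique hφ hρ (isStationaryMeasure_dirac hφ hfix),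
    Measure.dirac_apply' _ (measurableSet_singleton q)] at hne
  exact hne (Set.indicator_of_notMem (Set.mem_singleton_iff.not.2 hqp.symm) _)

end Atoms

/-! ### Time averages -/

theorem tendsto_integral_zero_of_tendsto_measure_compl {ι X : Type*} [MeasurableSpace X]
    {l : Filter ι} {F : Filter X} {ν : ι → Measure X} [∀ i, IsZeroOrProbabilityMeasure (ν i)]
    {g : X → ℝ} (hg : Measurable g) {C : ℝ} (hC : ∀ x, |g x| ≤ C) (hgF : Tendsto g F (𝓝 0))
    (hν : ∀ S ∈ F, Tendsto (fun i => ν i Sᶜ) l (𝓝 0)) :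
    Tendsto (fun i => ∫ x, g x ∂ν i) l (𝓝 0) := by
  rw [Metric.tendsto_nhds]
  intro ε hε
  set S := {x | |g x| < ε / 2}
  have hS : MeasurableSet S := measurableSet_lt hg.abs measurable_const
  have hSF : S ∈ F := by
    filter_upwards [Metric.tendsto_nhds.1 hgF (ε / 2) (half_pos hε)] with x hx
    rwa [dist_zero_right] at hx
  have hbound : ∀ i, |∫ x, g x ∂ν i| ≤ C * (ν i).real Sᶜ + ε / 2 := fun i => by
    have hle : ∀ x, |g x| ≤ Sᶜ.indicator (fun _ => C) x + ε / 2 := fun x => by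
      by_cases hx : x ∈ S
      · rw [Set.indicator_of_notMem (Set.notMem_compl_iff.2 hx), zero_add]
        exact le_of_lt hx
      · rw [Set.indicator_of_mem hx]
        linarith [hC x]
    have hind : Integrable (Sᶜ.indicator fun _ => C) (ν i) :=
      (integrable_const C).indicator hS.compl
    calc |∫ x, g x ∂ν i| ≤ ∫ x, |g x| ∂ν i := abs_integral_le_integral_abs
      _ ≤ ∫ x, (Sᶜ.indicator (fun _ => C) x + ε / 2) ∂ν i :=
          integral_mono (Integrable.of_bound hg.abs.aestronglyMeasurable C
            (Eventually.of_forall fun x => (abs_abs _).trans_le (hC x)))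
            (hind.add (integrable_const _)) hle
      _ = C * (ν i).real Sᶜ + (ν i).real Set.univ * (ε / 2) := by
          rw [integral_add hind (integrable_const _), integral_indicator_const _ hS.compl,
            integral_const, smul_eq_mul, smul_eq_mul, mul_comm C]
      _ ≤ C * (ν i).real Sᶜ + ε / 2 := by
          gcongr
          exact mul_le_of_le_one_left (by positivity) measureReal_le_one
  have hlim : Tendsto (fun i => C * (ν i).real Sᶜ + ε / 2) l (𝓝 (C * 0 + ε / 2)) :=
    (((ENNReal.tendsto_toReal ENNReal.zero_ne_top).comp (hν S hSF)).const_mul C).add_const _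
  filter_upwards [hlim.eventually_lt_const (show C * 0 + ε / 2 < ε by linarith)] with i hi
  rw [dist_zero_right]
  exact (hbound i).trans_lt hi

theorem tendsto_natFloor_sqrt_sq_div_atTop :
    Tendsto (fun T : ℝ => ((⌊√T⌋₊ ^ 2 : ℕ) : ℝ) / T) atTop (𝓝 1) := by
  have h := (((tendsto_nat_floor_div_atTop (R := ℝ)).comp Real.tendsto_sqrt_atTop).pow 2)
  rw [one_pow] at h
  refine h.congr' ?_
  filter_upwards [eventually_ge_atTop 0] with T hT
  simp only [Function.comp_apply, Nat.cast_pow, div_pow, Real.sq_sqrt hT]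

theorem tendsto_div_atTop_of_tendsto_sq {I : ℝ → ℝ} {C c : ℝ}
    (hI : ∀ (n : ℕ) (T : ℝ), n ≤ T → |I T - I n| ≤ C * (T - n + 1))
    (h : Tendsto (fun j : ℕ => I (j ^ 2 : ℕ) / (j ^ 2 : ℕ)) atTop (𝓝 c)) :
    Tendsto (fun T => I T / T) atTop (𝓝 c) := by
  set n : ℝ → ℕ := fun T => ⌊√T⌋₊ ^ 2
  have hr : Tendsto (fun T => (n T : ℝ) / T) atTop (𝓝 1) := tendsto_natFloor_sqrt_sq_div_atTop
  have hfloor : Tendsto (fun T : ℝ => ⌊√T⌋₊) atTop atTop :=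
    tendsto_nat_floor_atTop.comp Real.tendsto_sqrt_atTop
  have hmain : Tendsto (fun T => I (n T) / n T * (n T / T)) atTop (𝓝 c) := by
    have := (h.comp hfloor).mul hr
    rwa [mul_one] at this
  have hrest : Tendsto (fun T => (I T - I (n T)) / T) atTop (𝓝 0) := by
    have hlim : Tendsto (fun T : ℝ => C * (1 - n T / T + T⁻¹)) atTop (𝓝 0) := by
      simpa using ((hr.const_sub 1).add tendsto_inv_atTop_zero).const_mul C
    refine squeeze_zero_norm' ?_ hlim
    filter_upwards [eventually_gt_atTop 0] with T hT
    have hnT : (n T : ℝ) ≤ T :=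
      calc (n T : ℝ) = (⌊√T⌋₊ : ℝ) ^ 2 := Nat.cast_pow _ _
        _ ≤ √T ^ 2 := by gcongr; exact Nat.floor_le (Real.sqrt_nonneg T)
        _ = T := Real.sq_sqrt hT.le
    rw [norm_div, Real.norm_eq_abs, Real.norm_of_nonneg hT.le, div_le_iff₀ hT]
    calc |I T - I (n T)| ≤ C * (T - n T + 1) := hI _ _ hnT
      _ = C * (1 - n T / T + T⁻¹) * T := by field_simp
  have hsum := hmain.add hrest
  rw [add_zero] at hsum
  refine hsum.congr' ?_
  filter_upwards [hfloor.eventually_ne_atTop 0] with T hT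
  have : (n T : ℝ) ≠ 0 := Nat.cast_ne_zero.2 (pow_ne_zero 2 hT)
  rw [div_mul_div_cancel₀ this, ← add_div, add_sub_cancel]

namespace TimeDomain

variable {k : TimeDomain}

/-- The uniform distribution on the times before `n`, so that `∫ t, g t ∂k.uniformTime n` is the
average of `g` up to time `n`. It is the zero measure for `n = 0`. -/
noncomputable def uniformTime (k : TimeDomain) (n : ℕ) : Measure k.Time :=
  k.timeMeasure[|Set.Iio (k.natTime n)]

instance (n : ℕ) : IsZeroOrProbabilityMeasure (k.uniformTime n) :=
  inferInstanceAs (IsZeroOrProbabilityMeasure k.timeMeasure[|Set.Iio (k.natTime n)])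

instance (n : ℕ) [NeZero n] : IsProbabilityMeasure (k.uniformTime n) :=
  cond_isProbabilityMeasure_of_finite (by simp [timeMeasure_Iio_natTime, NeZero.ne n])
    (by simp [timeMeasure_Iio_natTime])

theorem uniformTime_apply_le (n : ℕ) (S : Set k.Time) :
    k.uniformTime n S ≤ k.timeMeasure S / n := by
  rw [uniformTime, cond_apply measurableSet_Iio, timeMeasure_Iio_natTime, mul_comm,
    ← div_eq_mul_inv]
  gcongr
  exact Set.inter_subset_right

theorem integral_uniformTime (n : ℕ) (g : k.Time → ℝ) :
    ∫ t, g t ∂k.uniformTime n = (∫ t in Set.Iio (k.natTime n), g t ∂k.timeMeasure) / n := by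
  rw [uniformTime, ProbabilityTheory.cond, integral_smul_measure, timeMeasure_Iio_natTime,
    ENNReal.toReal_inv, ENNReal.toReal_natCast, smul_eq_mul, inv_mul_eq_div]

theorem tendsto_integral_uniformTime_zero {g : k.Time → ℝ} (hg : Measurable g) {C : ℝ}
    (hC : ∀ t, |g t| ≤ C) (h : Tendsto g atTop (𝓝 0)) :
    Tendsto (fun n => ∫ t, g t ∂k.uniformTime n) atTop (𝓝 0) := by
  refine tendsto_integral_zero_of_tendsto_measure_compl hg hC h fun S hS => ?_
  obtain ⟨s, hs⟩ := mem_atTop_sets.1 hS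
  obtain ⟨N, hN⟩ := exists_natTime_ge s
  have hsub : Sᶜ ⊆ Set.Iio (k.natTime N) := fun t ht =>
    lt_of_not_ge fun hNt => ht (hs t (hN.trans hNt))
  have hlim : Tendsto (fun n : ℕ => (N : ℝ≥0∞) / n) atTop (𝓝 0) := by
    simpa using ENNReal.Tendsto.const_div ENNReal.tendsto_nat_nhds_top
      (.inr (ENNReal.natCast_ne_top N))
  refine tendsto_of_tendsto_of_tendsto_of_le_of_le tendsto_const_nhds hlim
    (fun _ => zero_le) fun n => ?_
  calc k.uniformTime n Sᶜ ≤ k.timeMeasure (Set.Iio (k.natTime N)) / n :=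
        (measure_mono hsub).trans (uniformTime_apply_le n _)
    _ = N / n := by rw [timeMeasure_Iio_natTime]

theorem integrableOn_of_abs_le {g : k.Time → ℝ} (hg : Measurable g) {C : ℝ}
    (hC : ∀ t, |g t| ≤ C) {S : Set k.Time} (hS : k.timeMeasure S ≠ ∞) :
    IntegrableOn g S k.timeMeasure :=
  Measure.integrableOn_of_bounded hS hg.aestronglyMeasurable (Eventually.of_forall hC)

theorem setIntegral_Iio_natTime_add {g : k.Time → ℝ} (hg : Measurable g) {C : ℝ}
    (hC : ∀ t, |g t| ≤ C) (m n : ℕ) :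
    ∫ t in Set.Iio (k.natTime (m + n)), g t ∂k.timeMeasure =
      ∫ t in Set.Iio (k.natTime m), g t ∂k.timeMeasure +
        ∫ t in Set.Iio (k.natTime n), g (k.natTime m + t) ∂k.timeMeasure := by
  have hshift : ∫ t in Set.Iio (k.natTime n), g (k.natTime m + t) ∂k.timeMeasure =
      ∫ t in Set.Ico (k.natTime m) (k.natTime (m + n)), g t ∂k.timeMeasure := by
    have hpre : Set.Iio (k.natTime n) = (k.natTime m + ·) ⁻¹' Set.Iio (k.natTime (m + n)) := by
      ext t
      rw [natTime_add]
      exact (add_lt_add_iff_left (k.natTime m)).symm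
    rw [hpre, ← setIntegral_map measurableSet_Iio hg.aestronglyMeasurable (by fun_prop),
      map_add_timeMeasure, Measure.restrict_restrict measurableSet_Iio, Set.inter_comm,
      Set.Ici_inter_Iio]
  rw [hshift, ← Set.Iio_union_Ico_eq_Iio (natTime_strictMono.monotone (Nat.le_add_right m n)),
    setIntegral_union (Set.disjoint_left.2 fun t h h' => not_lt.2 h'.1 (Set.mem_Iio.1 h))
      measurableSet_Ico]
  · exact integrableOn_of_abs_le hg hC (by simp [timeMeasure_Iio_natTime])
  · exact integrableOn_of_abs_le hg hC
      (by rw [natTime_add, timeMeasure_Ico_add_natTime]; exact ENNReal.natCast_ne_top n)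

theorem abs_integral_uniformTime_add_sub_le {g : k.Time → ℝ} (hg : Measurable g) {C : ℝ}
    (hC : ∀ t, |g t| ≤ C) (m n : ℕ) :
    |∫ t, g (k.natTime m + t) ∂k.uniformTime n - ∫ t, g t ∂k.uniformTime n| ≤
      2 * C * m / n := by
  have hle : ∀ a, |∫ t in Set.Iio (k.natTime m), g (a + t) ∂k.timeMeasure| ≤ C * m := fun a => by
    simpa [measureReal_def, timeMeasure_Iio_natTime] using
      norm_setIntegral_le_of_norm_le_const (μ := k.timeMeasure) (s := Set.Iio (k.natTime m))
        (f := fun t => g (a + t)) (by simp [timeMeasure_Iio_natTime]) fun t _ => hC (a + t)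
  have hm := setIntegral_Iio_natTime_add hg hC m n
  have hn := setIntegral_Iio_natTime_add hg hC n m
  have h₀ := hle 0
  simp only [zero_add] at h₀
  rw [add_comm n m] at hn
  rw [integral_uniformTime, integral_uniformTime, ← sub_div, abs_div, Nat.abs_cast]
  gcongr
  calc _ = |∫ t in Set.Iio (k.natTime m), g (k.natTime n + t) ∂k.timeMeasure -
          ∫ t in Set.Iio (k.natTime m), g t ∂k.timeMeasure| := by congr 1; linarith
    _ ≤ C * m + C * m := (abs_sub _ _).trans (add_le_add (hle _) h₀)
    _ = 2 * C * m := by ring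

theorem setOf_lt_natCast (n : ℕ) :
    {t : k.Time | ((t : ℝ≥0) : ℝ) < n} = Set.Iio (k.natTime n) := by
  ext t
  change ((t : ℝ≥0) : ℝ) < n ↔ (t : ℝ≥0) < n
  rw [← NNReal.coe_natCast, NNReal.coe_lt_coe]

theorem timeMeasure_setOf_lt_ne_top (T : ℝ) :
    k.timeMeasure {t : k.Time | ((t : ℝ≥0) : ℝ) < T} ≠ ∞ := by
  refine ne_top_of_le_ne_top (ENNReal.natCast_ne_top ⌈T⌉₊) ?_
  rw [← timeMeasure_Iio_natTime, ← setOf_lt_natCast]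
  exact measure_mono fun t (ht : ((t : ℝ≥0) : ℝ) < T) => ht.trans_le (Nat.le_ceil T)

theorem measureReal_setOf_lt_sdiff_le {n : ℕ} {T : ℝ} (hT : n ≤ T) :
    k.timeMeasure.real ({t : k.Time | ((t : ℝ≥0) : ℝ) < T} \ Set.Iio (k.natTime n)) ≤
      T - n + 1 := by
  have hsub : {t : k.Time | ((t : ℝ≥0) : ℝ) < T} \ Set.Iio (k.natTime n) ⊆
      Set.Ico (k.natTime n) (k.natTime n + k.natTime ⌈T - n⌉₊) := fun t ht => by
    refine ⟨not_lt.1 ht.2, ?_⟩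
    change (t : ℝ≥0) < (n : ℝ≥0) + (⌈T - n⌉₊ : ℝ≥0)
    rw [← NNReal.coe_lt_coe, NNReal.coe_add, NNReal.coe_natCast, NNReal.coe_natCast]
    linarith [Nat.le_ceil (T - n), show ((t : ℝ≥0) : ℝ) < T from ht.1]
  calc _ ≤ k.timeMeasure.real (Set.Ico (k.natTime n) (k.natTime n + k.natTime ⌈T - n⌉₊)) :=
        measureReal_mono hsub (by simp [timeMeasure_Ico_add_natTime])
    _ = ⌈T - n⌉₊ := by
        rw [measureReal_def, timeMeasure_Ico_add_natTime, ENNReal.toReal_natCast]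
    _ ≤ T - n + 1 := (Nat.ceil_lt_add_one (sub_nonneg.2 hT)).le

theorem tendsto_average_of_tendsto_sq {g : k.Time → ℝ} (hg : Measurable g) {C : ℝ}
    (hC : ∀ t, |g t| ≤ C) {c : ℝ}
    (h : Tendsto (fun j : ℕ => ∫ t, g t ∂k.uniformTime (j ^ 2)) atTop (𝓝 c)) :
    Tendsto (fun T : ℝ => 1 / T * ∫ t in {t : k.Time | ((t : ℝ≥0) : ℝ) < T}, g t ∂k.timeMeasure)
      atTop (𝓝 c) := by
  simp only [one_div_mul_eq_div]
  simp only [integral_uniformTime, ← setOf_lt_natCast] at h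
  refine tendsto_div_atTop_of_tendsto_sq (C := C) (fun n T hT => ?_) h
  have hfin := timeMeasure_setOf_lt_ne_top (k := k) T
  rw [setOf_lt_natCast, ← setIntegral_sdiff measurableSet_Iio (integrableOn_of_abs_le hg hC hfin)
    (setOf_lt_natCast (k := k) n ▸ fun t (ht : ((t : ℝ≥0) : ℝ) < n) => ht.trans_le hT)]
  refine (norm_setIntegral_le_of_norm_le_const (f := g)
    (measure_lt_top_mono Set.sdiff_subset hfin.lt_top) fun t _ => hC t).trans ?_
  gcongr
  · exact (abs_nonneg _).trans (hC 0)
  · exact measureReal_setOf_lt_sdiff_le hT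

end TimeDomain

/-! ### A law of large numbers -/

theorem ae_tendsto_zero_of_summable_integral_norm {X E : Type*} [MeasurableSpace X]
    [NormedAddCommGroup E] {μ : Measure X} {f : ℕ → X → E} (hf : ∀ n, Integrable (f n) μ)
    (hsum : Summable fun n => ∫ x, ‖f n x‖ ∂μ) :
    ∀ᵐ x ∂μ, Tendsto (fun n => f n x) atTop (𝓝 0) := by
  have hnorm : ∑' n, eLpNorm (f n) 1 μ ≠ ∞ := by
    simp_rw [eLpNorm_one_eq_lintegral_enorm, ← ofReal_integral_norm_eq_lintegral_enorm (hf _)]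
    exact hsum.tsum_ofReal_ne_top
  filter_upwards [summable_norm_of_tsum_eLpNorm_ne_top le_rfl (fun n => (hf n).1) hnorm]
    with x hx
  exact tendsto_zero_iff_norm_tendsto_zero.2 hx.tendsto_atTop_zero

theorem integral_sq_integral_le {X Ω : Type*} [MeasurableSpace X] [MeasurableSpace Ω]
    {ν : Measure X} [IsFiniteMeasure ν] {P : Measure Ω} [IsProbabilityMeasure P]
    {W : X → Ω → ℝ} (hW : Measurable (Function.uncurry W)) {C : ℝ} (hC : ∀ s ω, |W s ω| ≤ C)
    {D : Set (X × X)} (hD : ∀ p ∉ D, ∫ ω, W p.1 ω * W p.2 ω ∂P = 0) :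
    ∫ ω, (∫ s, W s ω ∂ν) ^ 2 ∂P ≤ C ^ 2 * (ν.prod ν).real D := by
  have hbound : ∀ p : X × X, ∀ ω, ‖W p.1 ω * W p.2 ω‖ ≤ C ^ 2 := fun p ω => by
    rw [norm_mul, sq]
    gcongr
    · exact (abs_nonneg _).trans (hC p.1 ω)
    · exact hC p.1 ω
    · exact hC p.2 ω
  have hmeas : Measurable fun q : Ω × X × X => W q.2.1 q.1 * W q.2.2 q.1 :=
    (hW.comp (measurable_snd.fst.prodMk measurable_fst)).mul
      (hW.comp (measurable_snd.snd.prodMk measurable_fst))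
  calc ∫ ω, (∫ s, W s ω ∂ν) ^ 2 ∂P = ∫ ω, ∫ p, W p.1 ω * W p.2 ω ∂ν.prod ν ∂P := by
        congr 1 with ω
        rw [sq, integral_prod_mul (fun s => W s ω) fun s => W s ω]
    _ = ∫ p, ∫ ω, W p.1 ω * W p.2 ω ∂P ∂ν.prod ν :=
        integral_integral_swap (Integrable.of_bound hmeas.aestronglyMeasurable (C ^ 2)
          (Eventually.of_forall fun q => hbound q.2 q.1))
    _ = ∫ p in D, ∫ ω, W p.1 ω * W p.2 ω ∂P ∂ν.prod ν :=
        (setIntegral_eq_integral_of_forall_compl_eq_zero hD).symm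
    _ ≤ C ^ 2 * (ν.prod ν).real D :=
        (le_abs_self _).trans (norm_setIntegral_le_of_norm_le_const (measure_lt_top _ _)
          fun p _ => norm_integral_le_of_norm_le_const (Eventually.of_forall (hbound p)) |>.trans
            (by simp))

theorem IsRDS.measurable_uncurry_apply {k : TimeDomain} {Ω : Type*} [mΩ : MeasurableSpace Ω]
    {ℱ : Filtration k.Time mΩ} {θ : k.Time → Ω → Ω} {φ : k.Time → Ω → (Circ ≃ₜ Circ)}
    (hφ : IsRDS ℱ θ φ) (x : Circ) : Measurable fun p : k.Time × Ω => φ p.1 p.2 x := by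
  refine measurable_of_tendsto_metrizable
    (f := fun n (p : k.Time × Ω) => φ (TimeDomain.dyadicCeil n p.1) p.2 x) (fun n => ?_)
    (tendsto_pi_nhds.2 fun p => hφ.tendsto_dyadicCeil p.1 p.2 x)
  have := (TimeDomain.countable_range_dyadicCeil (k := k) n).to_subtype
  have hrange : Measurable (Set.rangeFactorization (TimeDomain.dyadicCeil (k := k) n)) :=
    (TimeDomain.measurable_dyadicCeil n).subtype_mk
  have hg : Measurable fun q : Set.range (TimeDomain.dyadicCeil (k := k) n) × Ω =>
      φ q.1 q.2 x := measurable_from_prod_countable_right fun d => hφ.measurable_apply d x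
  exact hg.comp ((hrange.comp measurable_fst).prodMk measurable_snd)

namespace TimeDomain

variable {k : TimeDomain}

theorem uniformTime_zero : k.uniformTime 0 = 0 :=
  cond_eq_zero_of_meas_eq_zero ((timeMeasure_Iio_natTime 0).trans Nat.cast_zero)

theorem prod_uniformTime_le (m n : ℕ) :
    (k.uniformTime n).prod (k.uniformTime n)
      {p | p.2 < p.1 + k.natTime m ∧ p.1 < p.2 + k.natTime m} ≤ 2 * m / n := by
  set ν := k.uniformTime n
  set D : Set (k.Time × k.Time) := {p | p.1 ≤ p.2 ∧ p.2 < p.1 + k.natTime m}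
  have hDmeas : MeasurableSet D :=
    (measurableSet_le measurable_fst measurable_snd).inter
      (measurableSet_lt (f := fun p : k.Time × k.Time => p.2) measurable_snd (by fun_prop))
  have hD : ν.prod ν D ≤ m / n :=
    calc ν.prod ν D = ∫⁻ s, ν (Set.Ico s (s + k.natTime m)) ∂ν := Measure.prod_apply hDmeas
      _ ≤ ∫⁻ _, m / n ∂ν := lintegral_mono fun s => (uniformTime_apply_le n _).trans_eq
          (by rw [timeMeasure_Ico_add_natTime])
      _ ≤ m / n := by
          rw [lintegral_const]
          exact mul_le_of_le_one_right' prob_le_one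
  have hswap : ν.prod ν (Prod.swap ⁻¹' D) = ν.prod ν D :=
    Measure.measurePreserving_swap.measure_preimage hDmeas.nullMeasurableSet
  calc _ ≤ ν.prod ν (D ∪ Prod.swap ⁻¹' D) := measure_mono fun p hp =>
        (le_total p.1 p.2).imp (fun h => ⟨h, hp.1⟩) fun h => ⟨h, hp.2⟩
    _ ≤ m / n + m / n := (measure_union_le _ _).trans (add_le_add hD (hswap.trans_le hD))
    _ = 2 * m / n := by rw [← two_mul, mul_div_assoc]

section Uncorrelated

variable {Ω : Type*} [MeasurableSpace Ω] {P : Measure Ω} [IsProbabilityMeasure P]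
  {W : k.Time → Ω → ℝ} {C : ℝ} {m : ℕ}

theorem integral_sq_integral_uniformTime_le (hW : Measurable (Function.uncurry W))
    (hC : ∀ t ω, |W t ω| ≤ C)
    (hcorr : ∀ s t, s + k.natTime m ≤ t → ∫ ω, W s ω * W t ω ∂P = 0) (n : ℕ) :
    ∫ ω, (∫ t, W t ω ∂k.uniformTime n) ^ 2 ∂P ≤ C ^ 2 * (2 * m / n) := by
  rcases n.eq_zero_or_pos with rfl | hn
  · simp [uniformTime_zero]
  refine (integral_sq_integral_le hW hC (D := {p | p.2 < p.1 + k.natTime m ∧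
    p.1 < p.2 + k.natTime m}) fun p hp => ?_).trans ?_
  · rcases not_and_or.1 hp with h | h
    · exact hcorr _ _ (not_lt.1 h)
    · simpa only [mul_comm] using hcorr _ _ (not_lt.1 h)
  · gcongr
    refine (ENNReal.toReal_mono ?_ (prod_uniformTime_le m n)).trans_eq (by simp)
    exact ENNReal.div_ne_top (by finiteness) (Nat.cast_ne_zero.2 hn.ne')

theorem ae_tendsto_integral_uniformTime_sq_zero (hW : Measurable (Function.uncurry W))
    (hC : ∀ t ω, |W t ω| ≤ C)
    (hcorr : ∀ s t, s + k.natTime m ≤ t → ∫ ω, W s ω * W t ω ∂P = 0) :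
    ∀ᵐ ω ∂P, Tendsto (fun j : ℕ => ∫ t, W t ω ∂k.uniformTime (j ^ 2)) atTop (𝓝 0) := by
  have hmeas : ∀ n, Measurable fun ω => ∫ t, W t ω ∂k.uniformTime n := fun n =>
    (hW.stronglyMeasurable.comp_measurable measurable_swap).integral_prod_right'.measurable
  have hle : ∀ n ω, |∫ t, W t ω ∂k.uniformTime n| ≤ C := fun n ω => by
    refine (norm_integral_le_of_norm_le_const (f := fun t => W t ω)
      (Eventually.of_forall fun t => hC t ω)).trans ?_
    exact mul_le_of_le_one_right ((abs_nonneg _).trans (hC 0 ω)) measureReal_le_one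
  have hint : ∀ j : ℕ, Integrable (fun ω => (∫ t, W t ω ∂k.uniformTime (j ^ 2)) ^ 2) P :=
    fun j => Integrable.of_bound ((hmeas _).pow_const 2).aestronglyMeasurable (C ^ 2)
      (Eventually.of_forall fun ω => by
        rw [norm_pow, Real.norm_eq_abs]
        gcongr
        exact hle _ ω)
  have hsum : Summable fun j : ℕ => ∫ ω, ‖(∫ t, W t ω ∂k.uniformTime (j ^ 2)) ^ 2‖ ∂P := by
    refine Summable.of_nonneg_of_le (fun _ => integral_nonneg fun _ => norm_nonneg _)
      (fun j => ?_) ((Real.summable_one_div_nat_pow.2 one_lt_two).mul_left (C ^ 2 * (2 * m)))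
    simp only [norm_pow, Real.norm_eq_abs, sq_abs]
    exact (integral_sq_integral_uniformTime_le hW hC hcorr _).trans_eq (by push_cast; ring)
  filter_upwards [ae_tendsto_zero_of_summable_integral_norm hint hsum] with ω hω
  have habs := hω.sqrt
  simp only [Real.sqrt_sq_eq_abs, Real.sqrt_zero] at habs
  exact (tendsto_zero_iff_abs_tendsto_zero _).2 habs

end Uncorrelated

end TimeDomain

section LawOfLargeNumbers

variable {k : TimeDomain} {Ω : Type*} [mΩ : MeasurableSpace Ω] {P : Measure Ω}
  [IsProbabilityMeasure P] {ℱ : Filtration k.Time mΩ} {θ : k.Time → Ω → Ω}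
  {φ : k.Time → Ω → (Circ ≃ₜ Circ)} {ρ : Measure Circ}

theorem IsRDS.ae_tendsto_integral_sub_transitionOp (hθ : IsNoise P ℱ θ) (hφ : IsRDS ℱ θ φ)
    (m : ℕ) (f : C(Circ, ℝ)) (x : Circ) :
    ∀ᵐ ω ∂P, Tendsto (fun j : ℕ => ∫ t, (f (φ (t + k.natTime m) ω x) -
      hφ.transitionOp P (k.natTime m) f (φ t ω x)) ∂k.uniformTime (j ^ 2)) atTop (𝓝 0) := by
  set Pf := hφ.transitionOp P (k.natTime m) f
  set W : k.Time → Ω → ℝ := fun t ω => f (φ (t + k.natTime m) ω x) - Pf (φ t ω x)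
  have hC : ∀ t ω, |W t ω| ≤ ‖f‖ + ‖Pf‖ := fun t ω =>
    norm_sub_le_of_le (f.norm_coe_le_norm _) (Pf.norm_coe_le_norm _)
  refine TimeDomain.ae_tendsto_integral_uniformTime_sq_zero (m := m) (C := ‖f‖ + ‖Pf‖) ?_ hC ?_
  · have hmeas := hφ.measurable_uncurry_apply x
    exact (f.continuous.measurable.comp (hmeas.comp
      ((measurable_fst.add_const (k.natTime m)).prodMk measurable_snd))).sub
        (Pf.continuous.measurable.comp hmeas)
  · intro s t hst
    have hWs : Measurable[ℱ t] (W s) :=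
      ((f.continuous.measurable.comp (hφ.measurable_apply_past _ x)).mono (ℱ.mono hst) le_rfl).sub
        ((Pf.continuous.measurable.comp (hφ.measurable_apply_past _ x)).mono
          (ℱ.mono (le_self_add.trans hst)) le_rfl)
    have hWs_int : Integrable (W s) P := .of_bound
      (hWs.mono (ℱ.le t) le_rfl).aestronglyMeasurable _ (.of_forall (hC s))
    have hmul : ∀ (g : C(Circ, ℝ)) (u : k.Time),
        Integrable (fun ω => W s ω * g (φ u ω x)) P := fun g u =>
      hWs_int.mul_bdd (hφ.measurable_comp_apply g u x).aestronglyMeasurable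
        (.of_forall fun _ => g.norm_coe_le_norm _)
    calc ∫ ω, W s ω * W t ω ∂P
        = ∫ ω, W s ω * f (φ (t + k.natTime m) ω x) ∂P - ∫ ω, W s ω * Pf (φ t ω x) ∂P := by
          rw [← integral_sub (hmul f _) (hmul Pf t)]
          simp only [W, mul_sub]
      _ = 0 := sub_eq_zero.2 (hφ.integral_mul_apply_add hθ t (k.natTime m) f x hWs hWs_int)

theorem IsRDS.measurable_time (hφ : IsRDS ℱ θ φ) (ω : Ω) (x : Circ) :
    Measurable fun t => φ t ω x :=
  (hφ.measurable_uncurry_apply x).comp measurable_prodMk_right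

theorem IsRDS.abs_integral_uniformTime_sub_le (hφ : IsRDS ℱ θ φ) (f g : C(Circ, ℝ)) (ω : Ω)
    (x : Circ) (m n : ℕ) [NeZero n] (c : ℝ) :
    |∫ t, f (φ t ω x) ∂k.uniformTime n - c| ≤ 2 * ‖f‖ * m / n +
      |∫ t, (f (φ (t + k.natTime m) ω x) - g (φ t ω x)) ∂k.uniformTime n| +
      dist g (ContinuousMap.const Circ c) := by
  have hmeas : ∀ h : C(Circ, ℝ), Measurable fun t => h (φ t ω x) := fun h =>
    h.continuous.measurable.comp (hφ.measurable_time ω x)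
  have hf : Integrable (fun t => f (φ (t + k.natTime m) ω x)) (k.uniformTime n) :=
    .of_bound ((hmeas f).comp (measurable_id.add_const _)).aestronglyMeasurable ‖f‖
      (.of_forall fun _ => f.norm_coe_le_norm _)
  have hg : Integrable (fun t => g (φ t ω x)) (k.uniformTime n) :=
    .of_bound (hmeas g).aestronglyMeasurable ‖g‖ (.of_forall fun _ => g.norm_coe_le_norm _)
  have hshift : |∫ t, f (φ t ω x) ∂k.uniformTime n -
      ∫ t, f (φ (t + k.natTime m) ω x) ∂k.uniformTime n| ≤ 2 * ‖f‖ * m / n := by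
    simpa only [add_comm, abs_sub_comm] using TimeDomain.abs_integral_uniformTime_add_sub_le
      (hmeas f) (fun _ => f.norm_coe_le_norm _) m n
  have hconst : |∫ t, g (φ t ω x) ∂k.uniformTime n - c| ≤ dist g (ContinuousMap.const Circ c) := by
    have := norm_integral_le_of_norm_le_const (μ := k.uniformTime n)
      (f := fun t => g (φ t ω x) - c) (.of_forall fun t =>
        ContinuousMap.dist_apply_le_dist (f := g) (g := ContinuousMap.const Circ c) (φ t ω x))
    simpa [integral_sub hg (integrable_const c)] using this
  rw [integral_sub hf hg]
  exact (abs_sub_le _ _ _).trans (add_le_add ((abs_sub_le _ _ _).trans (by gcongr)) hconst)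

theorem StablySynchronising.ae_tendsto_integral_uniformTime (hθ : IsNoise P ℱ θ)
    (hφ : IsRDS ℱ θ φ) (h : StablySynchronising P φ) (hρ : IsStationaryMeasure P φ ρ)
    (f : C(Circ, ℝ)) (x : Circ) :
    ∀ᵐ ω ∂P, Tendsto (fun j : ℕ => ∫ t, f (φ t ω x) ∂k.uniformTime (j ^ 2)) atTop
      (𝓝 (∫ y, f y ∂ρ)) := by
  filter_upwards [ae_all_iff.2 fun m => hφ.ae_tendsto_integral_sub_transitionOp hθ m f x] with ω hω
  refine Metric.tendsto_nhds.2 fun ε hε => ?_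
  obtain ⟨m, hm⟩ := ((Metric.tendsto_nhds.1 (h.tendsto_transitionOp hφ hρ f)) (ε / 2)
    (half_pos hε)).exists
  have hshift : Tendsto (fun j : ℕ => 2 * ‖f‖ * m / ((j ^ 2 : ℕ) : ℝ)) atTop (𝓝 0) :=
    (tendsto_const_div_atTop_nhds_zero_nat _).comp (tendsto_pow_atTop two_ne_zero)
  have herr := hshift.add (hω m).abs
  rw [abs_zero, add_zero] at herr
  filter_upwards [herr.eventually_lt_const (half_pos hε), eventually_ne_atTop 0] with j hj hj0
  have : NeZero (j ^ 2) := ⟨pow_ne_zero 2 hj0⟩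
  rw [Real.dist_eq]
  exact (hφ.abs_integral_uniformTime_sub_le f _ ω x m (j ^ 2) _).trans_lt
    ((add_lt_add hj hm).trans_eq (add_halves ε))

end LawOfLargeNumbers

/-! ### Empirical measures -/

theorem lipschitzWith_integral_continuousMap {X : Type*} [TopologicalSpace X] [CompactSpace X]
    [MeasurableSpace X] [OpensMeasurableSpace X] (μ : Measure X) [IsZeroOrProbabilityMeasure μ] :
    LipschitzWith 1 fun f : C(X, ℝ) => ∫ x, f x ∂μ := by
  refine LipschitzWith.of_dist_le_mul fun f g => ?_
  rw [NNReal.coe_one, one_mul, dist_eq_norm, dist_eq_norm,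
    ← integral_sub (integrable_continuousMap μ f) (integrable_continuousMap μ g)]
  exact (norm_integral_le_of_norm_le_const (Eventually.of_forall (f - g).norm_coe_le_norm)).trans
    (mul_le_of_le_one_right (norm_nonneg _) measureReal_le_one)

theorem isClosed_setOf_tendsto_integral {ι X : Type*} [TopologicalSpace X] [CompactSpace X]
    [MeasurableSpace X] [OpensMeasurableSpace X] {l : Filter ι} {μ : ι → Measure X}
    [∀ i, IsZeroOrProbabilityMeasure (μ i)] {ν : Measure X} [IsZeroOrProbabilityMeasure ν] :
    IsClosed {f : C(X, ℝ) | Tendsto (fun i => ∫ x, f x ∂μ i) l (𝓝 (∫ x, f x ∂ν))} :=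
  (LipschitzWith.uniformEquicontinuous (fun i (f : C(X, ℝ)) => ∫ x, f x ∂μ i) 1
    fun i => lipschitzWith_integral_continuousMap (μ i)).equicontinuous.isClosed_setOfPred_tendsto
      (lipschitzWith_integral_continuousMap ν).continuous

section EmpiricalMeasure

variable {k : TimeDomain} {Ω : Type*} [mΩ : MeasurableSpace Ω] {P : Measure Ω}
  {ℱ : Filtration k.Time mΩ} {θ : k.Time → Ω → Ω} {φ : k.Time → Ω → (Circ ≃ₜ Circ)}
  {ρ : Measure Circ}

/-- The distribution of the position at a uniformly chosen time before `n` of the trajectory that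
starts at `x`. It is the zero measure for `n = 0`. -/
noncomputable def empiricalMeasure (φ : k.Time → Ω → (Circ ≃ₜ Circ)) (ω : Ω) (x : Circ) (n : ℕ) :
    Measure Circ :=
  (k.uniformTime n).map fun t => φ t ω x

instance (ω : Ω) (x : Circ) (n : ℕ) : IsZeroOrProbabilityMeasure (empiricalMeasure φ ω x n) :=
  inferInstanceAs (IsZeroOrProbabilityMeasure ((k.uniformTime n).map fun t => φ t ω x))

theorem IsRDS.integral_empiricalMeasure (hφ : IsRDS ℱ θ φ) (ω : Ω) (x : Circ) (n : ℕ)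
    {f : Circ → ℝ} (hf : Measurable f) :
    ∫ y, f y ∂empiricalMeasure φ ω x n = ∫ t, f (φ t ω x) ∂k.uniformTime n :=
  integral_map (hφ.measurable_time ω x).aemeasurable hf.aestronglyMeasurable

theorem StablySynchronising.ae_tendsto_integral_empiricalMeasure [IsProbabilityMeasure P]
    (hθ : IsNoise P ℱ θ) (hφ : IsRDS ℱ θ φ) (h : StablySynchronising P φ)
    (hρ : IsStationaryMeasure P φ ρ) :
    ∀ᵐ ω ∂P, ∀ x, x ≠ crackFun φ ω → ∀ f : C(Circ, ℝ),
      Tendsto (fun j : ℕ => ∫ y, f y ∂empiricalMeasure φ ω x (j ^ 2)) atTop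
        (𝓝 (∫ y, f y ∂ρ)) := by
  have := hρ.1
  have hc := h.ae_mem_contractiveSet hθ hφ
  filter_upwards [hc, ae_crackFun_ne hc (h.measure_crackEvent_eq_zero hθ hφ 0),
    ae_all_iff.2 fun i => h.ae_tendsto_integral_uniformTime hθ hφ hρ
      (TopologicalSpace.denseSeq C(Circ, ℝ) i) 0] with ω hω h₀ hdense x hx f
  have hlim : Tendsto (fun j : ℕ => ∫ y, f y ∂empiricalMeasure φ ω 0 (j ^ 2)) atTop
      (𝓝 (∫ y, f y ∂ρ)) := by
    refine (TopologicalSpace.denseRange_denseSeq C(Circ, ℝ)).induction_on f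
      isClosed_setOf_tendsto_integral fun i => ?_
    simpa only [hφ.integral_empiricalMeasure ω _ _ (ContinuousMap.continuous _).measurable]
      using hdense i
  have hsync := (isCrackPoint_crackFun hω).synced hx h₀.symm
  simp only [hφ.integral_empiricalMeasure ω _ _ f.continuous.measurable] at hlim ⊢
  have hmeas : ∀ z, Measurable fun t => f (φ t ω z) := fun z =>
    f.continuous.measurable.comp (hφ.measurable_time ω z)
  have hint : ∀ z n, Integrable (fun t => f (φ t ω z)) (k.uniformTime n) := fun z n =>
    .of_bound (hmeas z).aestronglyMeasurable ‖f‖ (.of_forall fun _ => f.norm_coe_le_norm _)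
  have hdiff := (TimeDomain.tendsto_integral_uniformTime_zero ((hmeas x).sub (hmeas 0))
    (C := ‖f‖ + ‖f‖) (fun t => norm_sub_le_of_le (f.norm_coe_le_norm _) (f.norm_coe_le_norm _))
    (tendsto_sub_of_tendsto_dist (CompactSpace.uniformContinuous_of_continuous f.continuous)
      hsync)).comp (tendsto_pow_atTop two_ne_zero)
  simpa [integral_sub (hint x _) (hint 0 _)] using hdiff.add hlim

theorem StablySynchronising.ae_tendsto_timeAverage [IsProbabilityMeasure P]
    (hθ : IsNoise P ℱ θ) (hφ : IsRDS ℱ θ φ) (h : StablySynchronising P φ)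
    (hρ : IsStationaryMeasure P φ ρ) {J : Set Circ} (hJ : IsPreconnected J)
    (hJfix : ∀ p ∈ frontier J, ¬ IsDetFixedPoint P φ p) :
    ∀ᵐ ω ∂P, ∀ x, x ≠ crackFun φ ω →
      Tendsto (fun T => timeAverage φ ω x J T) atTop (𝓝 (ρ.real J)) := by
  have := hρ.1
  have hJm := Circ.measurableSet_of_isPreconnected hJ
  have hnull : ρ (frontier J) = 0 := by
    refine (measure_null_iff_singleton (Circ.finite_frontier hJ).countable).2 fun p hp => ?_
    exact h.1.measure_singleton_eq_zero hφ hρ (hJfix p hp)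
  filter_upwards [h.ae_tendsto_integral_empiricalMeasure hθ hφ hρ] with ω hω x hx
  have hg : Measurable (J.indicator fun _ => (1 : ℝ)) := measurable_const.indicator hJm
  refine TimeDomain.tendsto_average_of_tendsto_sq (hg.comp (hφ.measurable_time ω x)) (C := 1)
    (fun t => ?_) ?_
  · exact (norm_indicator_le_norm_self (fun _ => (1 : ℝ)) _).trans_eq norm_one
  simp only [Function.comp_apply]
  simp only [← hφ.integral_empiricalMeasure ω x _ hg, integral_indicator_const _ hJm, smul_eq_mul,
    mul_one]
  refine (tendsto_add_atTop_iff_nat 1).1 ?_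
  let μ : ℕ → ProbabilityMeasure Circ := fun j => ⟨empiricalMeasure φ ω x ((j + 1) ^ 2),
    Measure.isProbabilityMeasure_map (hφ.measurable_time ω x).aemeasurable⟩
  have hμ : Tendsto μ atTop (𝓝 ⟨ρ, hρ.1⟩) :=
    tendsto_probabilityMeasure_iff_forall_integral_tendsto.2 fun f =>
      (hω x hx f).comp (tendsto_add_atTop_nat 1)
  exact (ENNReal.tendsto_toReal (measure_ne_top ρ J)).comp
    (ProbabilityMeasure.tendsto_measure_of_null_frontier_of_tendsto' hμ hnull)

end EmpiricalMeasure

theorem theorem4p5 {k : TimeDomain} {Ω : Type*} [mΩ : MeasurableSpace Ω]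
    (P : Measure Ω) [IsProbabilityMeasure P] (ℱ : Filtration k.Time mΩ)
    (θ : k.Time → Ω → Ω) (hθ : IsNoise P ℱ θ)
    (φ : k.Time → Ω → (Circ ≃ₜ Circ)) (hφ : IsRDS ℱ θ φ) :
    -- the event in question is measurable with respect to the future, and has probability 0 or 1
    MeasurableSet[futureSigma ℱ] (contractiveSet φ) ∧
    (P (contractiveSet φ) = 0 ∨ P (contractiveSet φ) = 1) ∧
    -- the dichotomy for the law of the crack point
    (P (contractiveSet φ) = 1 →
      (∀ x, P (crackEvent φ x) = 0) ∨
      (∃ p, IsDetFixedPoint P φ p ∧ ∀ᵐ ω ∂P, ω ∈ crackEvent φ p)) ∧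
    -- the characterisation of stable synchronisation
    (StablySynchronising P φ ↔
      P (contractiveSet φ) = 1 ∧ ∀ x, P (crackEvent φ x) = 0) ∧
    -- its consequences
    (StablySynchronising P φ →
      (∀ᵐ ω ∂P, ∀ h : ω ∈ contractiveSet φ,
        IsRepulsiveCrackPoint φ ω (crackPoint φ ⟨ω, h⟩)) ∧
      (∃ ρ : Measure Circ, IsStationaryMeasure P φ ρ ∧
        (∀ ρ' : Measure Circ, IsStationaryMeasure P φ ρ' → ρ' = ρ) ∧
        ∀ J : Set Circ, IsPreconnected J → (∀ p ∈ frontier J, ¬ IsDetFixedPoint P φ p) →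
          ∀ᵐ ω ∂P, ∀ h : ω ∈ contractiveSet φ, ∀ x, x ≠ crackPoint φ ⟨ω, h⟩ →
            Tendsto (fun T : ℝ => timeAverage φ ω x J T) atTop (𝓝 (ρ.real J)))) := by
  have hprob := mem_ae_iff_prob_eq_one (μ := P) (futureSigma_le ℱ _ hφ.measurableSet_contractiveSet)
  refine ⟨hφ.measurableSet_contractiveSet, hφ.measure_contractiveSet_eq_zero_or_one hθ,
    fun h => hφ.forall_measure_crackEvent_eq_zero_or hθ (hprob.2 h),
    (stablySynchronising_iff hθ hφ).trans (and_congr_left' hprob), fun h => ⟨?_, ?_⟩⟩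
  · exact hφ.ae_isRepulsiveCrackPoint hθ (h.ae_mem_contractiveSet hθ hφ)
      (h.measure_crackEvent_eq_zero hθ hφ)
  · obtain ⟨ρ, hρ⟩ := h.1.exists_isStationaryMeasure hθ hφ
    refine ⟨ρ, hρ, fun ρ' hρ' => h.1.stationaryMeasure_unique hφ hρ' hρ, fun J hJ hJfix => ?_⟩
    filter_upwards [h.ae_tendsto_timeAverage hθ hφ hρ hJ hJfix] with ω hω hc x hx
    exact hω x (by rwa [crackFun_of_mem hc])
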